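/- **Setting.** Let $\Theta\subseteq\mathbb R^p$ be closed and convex, and let $f:\mathbb R^p\to\mathbb R$ be bounded below on $\Theta$ and $\rho$-weakly convex on $\Theta$ for some $\rho>0$, i.e. $\theta\mapsto f(\theta)+\frac{\rho}{2}\|\theta\|^2$ is convex on $\Theta$. For $\theta\in\Theta$ write $\partial_\Theta f(\theta)$ for the set of $v$ with $f(\theta')-f(\theta)\ge\langle v,\theta'-\theta\rangle+o(\|\theta'-\theta\|)$ as $\theta'\to\theta$, $\theta'\in\Theta$ (it contains the subdifferential $\partial f(\theta)$, which is defined in the same way with $\theta'\to\theta$ in $\mathbb R^p$). Let $\varphi=f+\iota_\Theta$ ($\iota_\Theta=0$ on $\Theta$ and $+\infty$ off $\Theta$) and, for $\lambda>0$, let $\varphi_\lambda(\theta)=\inf_{\theta'}\big(\varphi(\theta')+\frac1{2\lambda}\|\theta'-\theta\|^2\big)$ be its Moreau envelope and $\mathrm{prox}_{\lambda\varphi}(\theta)$ the minimizer. A point $\theta^*\in\Theta$ is stationary for $f$ over $\Theta$ if $0\in v+N_\Theta(\theta^*)$ for some $v\in\partial f(\theta^*)$, where $N_\Theta(\theta^*)=\{u:\langle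 u,\theta-\theta^*\rangle\le0\ \forall\theta\in\Theta\}$. Let $(\mathbf x_n)_{n\ge1}$ be random elements of a measurable space $\Omega$, and for $0\le m<n$ let $\pi_n(\cdot\mid x_1,\dots,x_m)$ be a (fixed version of the) regular conditional distribution of $\mathbf x_n$ given $\mathbf x_1,\dots,\mathbf x_m$. For a probability measure $\pi$ on $\Omega$ put $$\Delta_{[m,n]}=\sup_{x_1,\dots,x_m\in\Omega}\big\|\pi_n(\cdot\mid x_1,\dots,x_m)-\pi\big\|_{TV},\qquad \|\mu-\nu\|_{TV}=\sup_A|\mu(A)-\nu(A)|.$$ Let $G:\Theta\times\Omega\to\mathbb R^p$ be measurable in its second argument, with $\mathbb E_{\mathbf x\sim\pi}[G(\theta,\mathbf x)]\in\partial_\Theta f(\theta)$ for all $\theta\in\Theta$, with $\theta\mapsto G(\theta,x)$ $L_1$-Lipschitz on $\Theta$ for every $x\in\Omega$ ($L_1>0$), and with $\|G(\theta,x)\|\le L$ for all $\theta\in\Theta$, $x\in\Omega$ ($0<L<\infty$). Let $\alpha_0\ge\alpha_1\ge\alpha_2\ge\cdots>0$ be step sizes ($\alpha_0$ is auxiliary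 and not used by the algorithm; e.g. $\alpha_0=\alpha_1$), let $\theta_1\in\Theta$ be deterministic, and let $\theta_{t+1}=\mathrm{proj}_\Theta(\theta_t-\alpha_tG(\theta_t,\mathbf x_{t+1}))$ for $t\ge1$. For $T\ge1$ let $\theta_T^{\mathrm{out}}$ be either $\theta_\tau$, where $\tau$ is independent of $(\mathbf x_n)_{n\ge 1}$ with $\mathbb P(\tau=j)=\alpha_j/\sum_{t=1}^T\alpha_t$ for $1\le j\le T$, or an element of $\arg\min_{\theta\in\{\theta_1,\dots,\theta_T\}}\|\nabla\varphi_{1/\hat\rho}(\theta)\|^2$. Fix $\hat\rho>\rho$. *Mixing condition (A1)* for integers $(k_t)_{t\ge1}$: $1\le k_t\le t$, $k_t\to\infty$, $\Delta_{[t-k_t,t+1]}\to0$ and $\sum_{t\ge1}\alpha_t\Delta_{[t-k_t,t+1]}<\infty$. **Theorem.** For every $\theta\in\mathbb R^p$ the proximal point $\mathrm{prox}_{\varphi/\hat\rho}(\theta)$ exists and is unique, and $\varphi_{1/\hat\rho}$ is differentiable at $\theta$. Moreover: **(i)** (Rate of convergence) If $(k_t)$ satisfies (A1), then for each $T\ge1$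 and either choice of output, $\|\nabla\varphi_{1/\hat\rho}(\theta_T^{\mathrm{out}})\|^2$ is integrable and $$\mathbb E\big\|\nabla\varphi_{1/\hat\rho}(\theta_T^{\mathrm{out}})\big\|^2\le\frac{\hat\rho^2L^2}{\hat\rho-\rho}\,\frac1{\sum_{t=1}^T\alpha_t}\Big[\frac{\varphi_{1/\hat\rho}(\theta_1)-\inf\varphi_{1/\hat\rho}}{\hat\rho L^2}+\frac12\sum_{t=1}^T\alpha_t^2+\frac{2(L_1+\hat\rho)}{\hat\rho-\rho}\sum_{t=1}^Tk_t\alpha_t\alpha_{t-k_t}+\frac2{\hat\rho-\rho}\sum_{t=1}^T\alpha_t\Delta_{[t-k_t,t+1]}\Big].$$ In particular, suppose that $\alpha_t=c/\sqrt t$ for all $t\ge1$ and some $c>0$, and that the data are exponentially mixing: there are $C$ and $r\in(0,1)$ with $\Delta_{[m,n]}\le Cr^{n-m}$ for all $1\le m<n$. Then $\tilde O(\varepsilon^{-4})$ samples suffice for $\mathbb E\|\nabla\varphi_{1/\hat\rho}(\theta_T^{\mathrm{out}})\|\le\varepsilon$: there are constants $K$ and $q\in\mathbb N$ such that for every $\varepsilon\in(0,1]$,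 every $T\ge1$ with $T\ge K\varepsilon^{-4}(1+\log(1/\varepsilon))^q$ and either choice of output, $\|\nabla\varphi_{1/\hat\rho}(\theta_T^{\mathrm{out}})\|$ is integrable with expectation at most $\varepsilon$ (one sample is used per iteration). **(ii)** (Global convergence) If $(k_t)$ satisfies (A1), $\sum_tk_t\alpha_t\alpha_{t-k_t}<\infty$ and $\sum_t\alpha_t=\infty$, then almost surely $\|\nabla\varphi_{1/\hat\rho}(\theta_t)\|\to0$ and $\|\nabla\varphi_{1/\hat\rho}(\hat\theta_t)\|\to0$ as $t\to\infty$, where $\hat\theta_t=\mathrm{prox}_{\varphi/\hat\rho}(\theta_t)$. If moreover $f$ is continuously differentiable on an open set containing $\Theta$, then almost surely every limit point of $(\theta_t)$ is a stationary point of $f$ over $\Theta$, and, if the sequence $(\theta_t)$ is bounded (e.g. if $\Theta$ is compact), the set of stationary points is non-empty and the distance of $\theta_t$ to it tends to $0$. -/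

import Mathlib

open MeasureTheory ProbabilityTheory Filter Topology

namespace ProjSGD

/-! ### Weakly convex functions on a closed convex set -/

section Deterministic

variable {E : Type*} [NormedAddCommGroup E] [InnerProductSpace ℝ E]

/-- `f` is `ρ`-weakly convex on the (convex) set `Θ`: `θ ↦ f θ + (ρ/2) ‖θ‖²` is convex on `Θ`. -/
def WeaklyConvexOn (Θ : Set E) (ρ : ℝ) (f : E → ℝ) : Prop :=
  ConvexOn ℝ Θ (fun θ => f θ + ρ / 2 * ‖θ‖ ^ 2)

/-- The (regular) subdifferential at `z` of `f` regarded as a function on `D` with value `+∞`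
off `D`: all `v` with `f θ - f z ≥ ⟪v, θ - z⟫ + o(‖θ - z‖)` as `θ → z` in `D`.
`D = Set.univ` gives the subdifferential of a function that is finite everywhere. -/
def subdifferential (D : Set E) (f : E → ℝ) (z : E) : Set E :=
  {v | ∀ ε > 0, ∀ᶠ θ in 𝓝[D] z, f θ - f z ≥ inner ℝ v (θ - z) - ε * ‖θ - z‖}

/-- The normal cone of `Θ` at `z`. -/
def normalCone (Θ : Set E) (z : E) : Set E :=
  {u | ∀ θ ∈ Θ, inner ℝ u (θ - z) ≤ 0}

/-- First-order stationary points of `f` over `Θ`: `0 ∈ v + N_Θ(z)` for some `v ∈ ∂f(z)`. -/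
def stationaryPoints (Θ : Set E) (f : E → ℝ) : Set E :=
  {z | z ∈ Θ ∧ ∃ v ∈ subdifferential Set.univ f z, ∃ u ∈ normalCone Θ z, v + u = 0}

/-- The Moreau envelope `φ_lam` of `φ = f + ι_Θ`; as `φ = +∞` off `Θ`, the infimum is
over `Θ`. -/
noncomputable def moreauEnvelope (Θ : Set E) (f : E → ℝ) (lam : ℝ) (z : E) : ℝ :=
  ⨅ y : Θ, (f y + 1 / (2 * lam) * ‖(y : E) - z‖ ^ 2)

/-- `y` minimizes `φ + ‖· - z‖² / (2 lam)`, where `φ = f + ι_Θ`. -/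
def IsProxPoint (Θ : Set E) (f : E → ℝ) (lam : ℝ) (z y : E) : Prop :=
  y ∈ Θ ∧ ∀ w ∈ Θ, f y + 1 / (2 * lam) * ‖y - z‖ ^ 2 ≤ f w + 1 / (2 * lam) * ‖w - z‖ ^ 2

/-- The proximal point of `z` (an arbitrary vector if there is no minimizer). -/
noncomputable def prox (Θ : Set E) (f : E → ℝ) (lam : ℝ) (z : E) : E :=
  Classical.epsilon (IsProxPoint Θ f lam z)

/-- `y` is the Euclidean projection of `z` to `Θ`. -/
def IsProj (Θ : Set E) (z y : E) : Prop :=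
  y ∈ Θ ∧ ∀ w ∈ Θ, ‖y - z‖ ≤ ‖w - z‖

end Deterministic

/-! ### Dependent data -/

section Data

variable {X S : Type*} [MeasurableSpace X]

/-- Total variation distance of two probability measures,
`sup_A |μ A - ν A|` over measurable sets `A`. -/
noncomputable def tvDist (μ ν : Measure X) : ℝ :=
  ⨆ A : {A : Set X // MeasurableSet A}, |μ.real A - ν.real A|

/-- The observed history `(x_1, …, x_m)`. -/
def history (x : ℕ → S → X) (m : ℕ) (ω : S) : Finset.Icc 1 m → X :=
  fun i => x i ω

/-- `Δ_{[m,n]}`: the worst case over histories `(x_1, …, x_m)` of the total variation distance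
between the conditional distribution `κ m n` of `x_n` given `(x_1, …, x_m)` and `π`. -/
noncomputable def mixingTV (κ : (m n : ℕ) → Kernel (Finset.Icc 1 m → X) X) (π : Measure X)
    (m n : ℕ) : ℝ :=
  ⨆ h : Finset.Icc 1 m → X, tvDist (κ m n h) π

/-- The mixing condition for step sizes `α` and lags `k` (terms are indexed by `t ≥ 1`;
the term `t = 0` in the sum is irrelevant). -/
structure MixingCondition (κ : (m n : ℕ) → Kernel (Finset.Icc 1 m → X) X) (π : Measure X)
    (α : ℕ → ℝ) (k : ℕ → ℕ) : Prop where
  lag_mem : ∀ t, 1 ≤ t → 1 ≤ k t ∧ k t ≤ t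
  lag_tendsto : Tendsto k atTop atTop
  tendsto_zero : Tendsto (fun t => mixingTV κ π (t - k t) (t + 1)) atTop (𝓝 0)
  summable : Summable (fun t => α t * mixingTV κ π (t - k t) (t + 1))

/-- Exponential mixing: `Δ_{[m,n]} ≤ C * r ^ (n - m)` for some `C` and some `r ∈ (0,1)`. -/
def ExponentiallyMixing (κ : (m n : ℕ) → Kernel (Finset.Icc 1 m → X) X) (π : Measure X) : Prop :=
  ∃ C r : ℝ, 0 < r ∧ r < 1 ∧ ∀ m n : ℕ, 1 ≤ m → m < n → mixingTV κ π m n ≤ C * r ^ (n - m)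

end Data

/-! ### The algorithm -/

section Algorithm

variable {E : Type*} [NormedAddCommGroup E] [InnerProductSpace ℝ E]
  {X S : Type*} [MeasurableSpace X] [MeasurableSpace S]

/-- `θ` is generated by the projected stochastic subgradient method from `θ₁ ∈ Θ`
(the value `θ 0` is not used):
`θ_{t+1} = proj_Θ (θ_t - α_t G(θ_t, x_{t+1}))` for `t ≥ 1`. -/
structure IsProjectedSGD (Θ : Set E) (G : E → X → E) (α : ℕ → ℝ) (x : ℕ → S → X) (θ₁ : E)
    (θ : ℕ → S → E) : Prop where
  init_mem : θ₁ ∈ Θ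
  init : ∀ ω, θ 1 ω = θ₁
  step : ∀ t, 1 ≤ t → ∀ ω,
    IsProj Θ (θ t ω - α t • G (θ t ω) (x (t + 1) ω)) (θ (t + 1) ω)

/-- `out` is the iterate `θ_τ`, with `τ` sampled from `{1, …, T}` independently of the data, and
`P(τ = j) = α_j / ∑_{t=1}^T α_t`. -/
def IsRandomOutput (P : Measure S) (x : ℕ → S → X) (α : ℕ → ℝ) (θ : ℕ → S → E) (T : ℕ)
    (out : S → E) : Prop :=
  ∃ τ : S → ℕ, Measurable τ ∧ IndepFun τ (fun ω (n : ℕ) => x (n + 1) ω) P ∧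
    (∀ j ∈ Finset.Icc 1 T, P.real {ω | τ ω = j} = α j / ∑ t ∈ Finset.Icc 1 T, α t) ∧
    ∀ ω, out ω = θ (τ ω) ω

/-- `out` is an iterate among `θ_1, …, θ_T` that minimizes `g²`. -/
def IsBestOutput (g : E → ℝ) (θ : ℕ → S → E) (T : ℕ) (out : S → E) : Prop :=
  ∀ ω, (∃ t ∈ Finset.Icc 1 T, out ω = θ t ω) ∧
    ∀ t ∈ Finset.Icc 1 T, g (out ω) ^ 2 ≤ g (θ t ω) ^ 2

end Algorithm

end ProjSGD

/-!
Write `p z` for the proximal point of `z` and `D z = p z - z` for its displacement. As `G` is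
unbiased, `f` has a subgradient at every point of `Θ`; it is therefore lower semicontinuous on `Θ`,
so that `p` is well defined, and the strong convexity of the proximal objective makes `p`
cocoercive. It follows that the Moreau envelope `φ` has gradient `-ρ' D`, that `D` is
`ρ' / (ρ' - ρ)`-Lipschitz, and that a subgradient `v` at `z ∈ Θ` satisfies
`⟪v, D z⟫ ≤ -(ρ' - ρ) ‖D z‖²` (`WeaklyConvexOn.inner_displacement_le`).

Comparing `θ_{t+1}` with `p θ_t` shows that
`φ θ_{t+1} ≤ φ θ_t + ρ' α_t ⟪D θ_t, G θ_t x_{t+1}⟫ + (ρ' / 2) L² α_t²`. The data being dependent,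
the inner product has no useful conditional mean given the immediate past. It is compared with its
value at the iterate `k_t` steps earlier, at the price of the drift `L k_t α_{t-k_t}`; conditioning
on the history up to time `t - k_t` replaces the law of `x_{t+1}` by `π`, at a price
proportional to `Δ_{[t-k_t,t+1]}`; then the mean under `π` is carried back to `θ_t`
(`IsOracle.expected_inner_le`). Summation over `t` gives the rate (`IsOracle.sum_expected_le`).

This bound needs only `k_t ≤ t`. With `α_t = c / √t` and exponential mixing it is applied,
for each `T` separately, with `k_t = min (t, K)` and `K` of order `log T`: the right-hand side is
then `O(log² T)` while `∑ α_t` is at least `c √T`.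

For the almost sure statements, the rate gives `∑ α_t ‖D θ_t‖² < ∞` almost surely. As
`‖D θ_t‖²` changes by `O(α_t)` per step, `∑ α_t² < ∞` and `∑ α_t = ∞`, it tends to `0`
(`tendsto_zero_of_summable_mul`). A limit point `z` of the iterates thus satisfies `p z = z`, and
first-order optimality of `z` in its own proximal problem is stationarity for `f`.
-/

namespace ProjSGD

/-! ### Weak convexity, proximal points and the Moreau envelope -/

section Normed

variable {E : Type*} [NormedAddCommGroup E] {Θ : Set E} {f : E → ℝ} {ρ' : ℝ}

lemma isProxPoint_iff {z y : E} :
    IsProxPoint Θ f (1 / ρ') z y ↔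
      y ∈ Θ ∧ ∀ w ∈ Θ, f y + ρ' / 2 * ‖y - z‖ ^ 2 ≤ f w + ρ' / 2 * ‖w - z‖ ^ 2 := by
  have : 1 / (2 * (1 / ρ')) = ρ' / 2 := by rw [one_div, mul_inv, one_div, inv_inv]; ring
  simp only [IsProxPoint, this]

lemma moreauEnvelope_le {z w : E} (hfb : BddBelow (f '' Θ)) (hρ' : 0 < ρ') (hw : w ∈ Θ) :
    moreauEnvelope Θ f (1 / ρ') z ≤ f w + ρ' / 2 * ‖w - z‖ ^ 2 := by
  have e : 1 / (2 * (1 / ρ')) = ρ' / 2 := by rw [one_div, mul_inv, one_div, inv_inv]; ring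
  unfold moreauEnvelope
  rw [e]
  obtain ⟨b, hb⟩ := hfb
  refine ciInf_le (f := fun y : Θ => f y + ρ' / 2 * ‖(y : E) - z‖ ^ 2) ⟨b, ?_⟩ ⟨w, hw⟩
  rintro _ ⟨y, rfl⟩
  have := hb ⟨y, y.2, rfl⟩
  simp only
  nlinarith [sq_nonneg ‖(y : E) - z‖]

lemma IsProxPoint.moreauEnvelope_eq {z y : E} (hfb : BddBelow (f '' Θ)) (hρ' : 0 < ρ')
    (hy : IsProxPoint Θ f (1 / ρ') z y) :
    moreauEnvelope Θ f (1 / ρ') z = f y + ρ' / 2 * ‖y - z‖ ^ 2 := by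
  have e : 1 / (2 * (1 / ρ')) = ρ' / 2 := by rw [one_div, mul_inv, one_div, inv_inv]; ring
  refine le_antisymm (moreauEnvelope_le hfb hρ' hy.1) ?_
  have : Nonempty Θ := ⟨⟨y, hy.1⟩⟩
  unfold moreauEnvelope
  rw [e]
  exact le_ciInf fun w => (isProxPoint_iff.1 hy).2 w w.2

/-- The projection is the proximal map of the zero function. -/
lemma isProj_iff_isProxPoint {z y : E} :
    IsProj Θ z y ↔ IsProxPoint Θ (fun _ => 0) (1 / 1) z y := by
  rw [isProxPoint_iff]
  refine and_congr_right fun _ => forall₂_congr fun w _ => ?_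
  rw [← sq_le_sq₀ (norm_nonneg _) (norm_nonneg _)]
  constructor <;> intro h <;> linarith

end Normed

section Envelope

variable {E : Type*} [NormedAddCommGroup E] [InnerProductSpace ℝ E]
  {Θ : Set E} {f : E → ℝ} {ρ ρ' : ℝ}

/-- Weak convexity along a segment. -/
lemma WeaklyConvexOn.segment_le (hf : WeaklyConvexOn Θ ρ f) {z w : E} (hz : z ∈ Θ) (hw : w ∈ Θ)
    {s : ℝ} (hs0 : 0 ≤ s) (hs1 : s ≤ 1) :
    z + s • (w - z) ∈ Θ ∧
      f (z + s • (w - z)) ≤ (1 - s) * f z + s * f w + ρ / 2 * (s * (1 - s)) * ‖w - z‖ ^ 2 := by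
  have e : z + s • (w - z) = (1 - s) • z + s • w := by module
  have hn : ‖z + s • (w - z)‖ ^ 2
      = (1 - s) * ‖z‖ ^ 2 + s * ‖w‖ ^ 2 - s * (1 - s) * ‖w - z‖ ^ 2 := by
    rw [norm_add_sq_real, norm_sub_sq_real, inner_smul_right, inner_sub_right, norm_smul, mul_pow,
      norm_sub_sq_real, Real.norm_eq_abs, sq_abs, real_inner_self_eq_norm_sq,
      real_inner_comm z w]
    ring
  have h1s : 0 ≤ 1 - s := by linarith
  refine ⟨e ▸ hf.1 hz hw h1s hs0 (by ring), ?_⟩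
  have h := hf.2 hz hw h1s hs0 (by ring)
  rw [← e] at h
  simp only [smul_eq_mul] at h
  rw [hn] at h
  nlinarith [h]

/-- If `a + s * b ≤ 0` for all small positive `s` then `a ≤ 0`. -/
lemma nonpos_of_forall_add_mul_nonpos {a b : ℝ} (h : ∀ s, 0 < s → s < 1 → a + s * b ≤ 0) :
    a ≤ 0 := by
  have ht : Tendsto (fun s : ℝ => a + s * b) (𝓝[>] 0) (𝓝 (a + 0 * b)) :=
    (Continuous.tendsto (by fun_prop) 0).mono_left nhdsWithin_le_nhds
  rw [zero_mul, add_zero] at ht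
  refine le_of_tendsto ht ?_
  filter_upwards [Ioo_mem_nhdsGT (zero_lt_one' ℝ)] with s hs using h s hs.1 hs.2

/-- For weakly convex functions the local subgradient inequality is global, with a quadratic
error in place of `o(‖w - z‖)`. -/
lemma WeaklyConvexOn.subgradient_le (hf : WeaklyConvexOn Θ ρ f) {z w v : E} (hz : z ∈ Θ)
    (hw : w ∈ Θ) (hv : v ∈ subdifferential Θ f z) :
    f z + inner ℝ v (w - z) - ρ / 2 * ‖w - z‖ ^ 2 ≤ f w := by
  have key : ∀ ε > 0,
      f z + inner ℝ v (w - z) - ρ / 2 * ‖w - z‖ ^ 2 - ε * ‖w - z‖ - f w ≤ 0 := by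
    intro ε hε
    have ht : Tendsto (fun s : ℝ => z + s • (w - z)) (𝓝[Set.Ioo 0 1] 0) (𝓝[Θ] z) := by
      refine tendsto_nhdsWithin_iff.2 ⟨?_, ?_⟩
      · have : Tendsto (fun s : ℝ => z + s • (w - z)) (𝓝 0) (𝓝 (z + (0 : ℝ) • (w - z))) :=
          Continuous.tendsto (by fun_prop) 0
        rw [zero_smul, add_zero] at this
        exact this.mono_left nhdsWithin_le_nhds
      · filter_upwards [self_mem_nhdsWithin] with s hs
        exact (hf.segment_le hz hw hs.1.le hs.2.le).1
    have hev := ht.eventually (hv ε hε)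
    have hlim : Tendsto (fun s : ℝ => f z + inner ℝ v (w - z) - ρ / 2 * ‖w - z‖ ^ 2
        - ε * ‖w - z‖ - f w + s * (ρ / 2 * ‖w - z‖ ^ 2)) (𝓝[Set.Ioo 0 1] 0)
        (𝓝 (f z + inner ℝ v (w - z) - ρ / 2 * ‖w - z‖ ^ 2 - ε * ‖w - z‖ - f w
          + 0 * (ρ / 2 * ‖w - z‖ ^ 2))) :=
      (Continuous.tendsto (by fun_prop) 0).mono_left nhdsWithin_le_nhds
    rw [zero_mul, add_zero] at hlim
    have : (𝓝[Set.Ioo (0 : ℝ) 1] 0).NeBot := by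
      rw [nhdsWithin_Ioo_eq_nhdsGT zero_lt_one]; infer_instance
    refine le_of_tendsto hlim ?_
    filter_upwards [hev, self_mem_nhdsWithin] with s hs hs1
    have h2 := (hf.segment_le hz hw hs1.1.le hs1.2.le).2
    rw [add_sub_cancel_left, inner_smul_right, norm_smul, Real.norm_eq_abs,
      abs_of_pos hs1.1] at hs
    refine nonpos_of_mul_nonpos_right ?_ hs1.1
    nlinarith
  have h := nonpos_of_forall_add_mul_nonpos
    (a := f z + inner ℝ v (w - z) - ρ / 2 * ‖w - z‖ ^ 2 - f w) (b := -‖w - z‖)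
    (fun s hs _ => by linarith [key s hs])
  linarith

/-- The objective `f + ρ'/2 ‖· - z‖²` is `(ρ' - ρ)`-strongly convex, so it grows quadratically
away from its minimizer. -/
lemma WeaklyConvexOn.prox_growth (hf : WeaklyConvexOn Θ ρ f) {z y w : E}
    (hy : IsProxPoint Θ f (1 / ρ') z y) (hw : w ∈ Θ) :
    f y + ρ' / 2 * ‖y - z‖ ^ 2 + (ρ' - ρ) / 2 * ‖w - y‖ ^ 2 ≤ f w + ρ' / 2 * ‖w - z‖ ^ 2 := by
  rw [isProxPoint_iff] at hy
  have h := nonpos_of_forall_add_mul_nonpos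
    (a := f y + ρ' / 2 * ‖y - z‖ ^ 2 + (ρ' - ρ) / 2 * ‖w - y‖ ^ 2
      - (f w + ρ' / 2 * ‖w - z‖ ^ 2)) (b := -((ρ' - ρ) / 2 * ‖w - y‖ ^ 2)) ?_
  · linarith
  intro s hs0 hs1
  obtain ⟨hm, hle⟩ := hf.segment_le hy.1 hw hs0.le hs1.le
  have hmin := hy.2 _ hm
  have e1 : ‖y + s • (w - y) - z‖ ^ 2
      = ‖y - z‖ ^ 2 + 2 * s * inner ℝ (y - z) (w - y) + s ^ 2 * ‖w - y‖ ^ 2 := by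
    rw [show y + s • (w - y) - z = (y - z) + s • (w - y) by abel, norm_add_sq_real,
      inner_smul_right, norm_smul, mul_pow, Real.norm_eq_abs, sq_abs]
    ring
  have e2 : ‖w - z‖ ^ 2 = ‖y - z‖ ^ 2 + 2 * inner ℝ (y - z) (w - y) + ‖w - y‖ ^ 2 := by
    rw [show w - z = (y - z) + (w - y) by abel, norm_add_sq_real]
  rw [e1] at hmin
  rw [e2]
  refine nonpos_of_mul_nonpos_right ?_ hs0
  nlinarith

lemma WeaklyConvexOn.prox_unique (hf : WeaklyConvexOn Θ ρ f) (hρ' : ρ < ρ') {z y y' : E}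
    (hy : IsProxPoint Θ f (1 / ρ') z y) (hy' : IsProxPoint Θ f (1 / ρ') z y') : y' = y := by
  have h1 := hf.prox_growth hy hy'.1
  have h2 := (isProxPoint_iff.1 hy').2 y hy.1
  have h3 : ‖y' - y‖ ^ 2 ≤ 0 := nonpos_of_mul_nonpos_right (by linarith)
    (show 0 < (ρ' - ρ) / 2 by linarith)
  exact sub_eq_zero.1 (norm_eq_zero.1 (pow_eq_zero_iff two_ne_zero |>.1
    (le_antisymm h3 (sq_nonneg _))))

/-- Existence of proximal points. Having a subgradient at every point, `f` is lower
semicontinuous on `Θ`, so that a minimizing sequence converges to a minimizer along a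
subsequence. -/
lemma WeaklyConvexOn.exists_isProxPoint [ProperSpace E] (hΘ : IsClosed Θ) (hne : Θ.Nonempty)
    (hf : WeaklyConvexOn Θ ρ f) (hfb : BddBelow (f '' Θ))
    (hs : ∀ z ∈ Θ, (subdifferential Θ f z).Nonempty) (hρ' : 0 < ρ') (z : E) :
    ∃ y, IsProxPoint Θ f (1 / ρ') z y := by
  obtain ⟨b, hb⟩ := hfb
  have hb' : ∀ w ∈ Θ, b ≤ f w := fun w hw => hb ⟨w, hw, rfl⟩
  set h : E → ℝ := fun w => f w + ρ' / 2 * ‖w - z‖ ^ 2 with hh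
  have hhb : ∀ w ∈ Θ, b ≤ h w := fun w hw => by
    have := hb' w hw
    simp only [hh]; nlinarith [sq_nonneg ‖w - z‖]
  have hbdd : BddBelow (h '' Θ) := ⟨b, by rintro _ ⟨w, hw, rfl⟩; exact hhb w hw⟩
  obtain ⟨u, -, hu, hmem⟩ := exists_seq_tendsto_sInf (hne.image h) hbdd
  choose y hy hyu using hmem
  obtain ⟨B, hB⟩ := hu.bddAbove_range
  have hball : ∀ n, y n ∈ Metric.closedBall z (Real.sqrt (2 / ρ' * (B - b))) := by
    intro n
    rw [Metric.mem_closedBall, dist_eq_norm]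
    refine Real.le_sqrt_of_sq_le ?_
    have h1 : h (y n) ≤ B := (hyu n).symm ▸ hB ⟨n, rfl⟩
    have h2 := hb' _ (hy n)
    simp only [hh] at h1
    rw [div_mul_eq_mul_div, le_div_iff₀ hρ']
    nlinarith
  obtain ⟨a, -, ψ, hψ, hlim⟩ := (isCompact_closedBall _ _).tendsto_subseq hball
  have ha : a ∈ Θ := hΘ.mem_of_tendsto hlim (Eventually.of_forall fun n => hy _)
  refine ⟨a, isProxPoint_iff.2 ⟨ha, fun w hw => ?_⟩⟩
  obtain ⟨v, hv⟩ := hs a ha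
  have hle : ∀ n, f a + inner ℝ v (y (ψ n) - a) - ρ / 2 * ‖y (ψ n) - a‖ ^ 2
      + ρ' / 2 * ‖y (ψ n) - z‖ ^ 2 ≤ u (ψ n) := fun n => by
    have := hf.subgradient_le ha (hy (ψ n)) hv
    rw [← hyu]; simp only [hh]; linarith
  have hcont : Continuous fun q : E => f a + inner ℝ v (q - a) - ρ / 2 * ‖q - a‖ ^ 2
      + ρ' / 2 * ‖q - z‖ ^ 2 := by fun_prop
  have hl := le_of_tendsto_of_tendsto' ((hcont.tendsto a).comp hlim)
    (hu.comp hψ.tendsto_atTop) hle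
  have hi := csInf_le hbdd ⟨w, hw, rfl⟩
  simp only [sub_self, inner_zero_right, norm_zero] at hl
  simp only [hh] at hi hl
  linarith

variable {p : E → E}

/-- Cocoercivity of the proximal map. -/
lemma WeaklyConvexOn.prox_cocoercive (hf : WeaklyConvexOn Θ ρ f)
    (hp : ∀ z, IsProxPoint Θ f (1 / ρ') z (p z)) (z w : E) :
    (ρ' - ρ) * ‖p z - p w‖ ^ 2 ≤ ρ' * inner ℝ (p z - p w) (z - w) := by
  have h1 := hf.prox_growth (hp z) (hp w).1
  have h2 := hf.prox_growth (hp w) (hp z).1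
  have e : ‖p w - z‖ ^ 2 + ‖p z - w‖ ^ 2 - ‖p z - z‖ ^ 2 - ‖p w - w‖ ^ 2
      = 2 * inner ℝ (p z - p w) (z - w) := by
    simp only [norm_sub_sq_real, inner_sub_left, inner_sub_right]
    ring
  rw [norm_sub_rev (p w) (p z)] at h1
  linear_combination h1 + h2 + ρ' / 2 * e

/-- The displacement `p z - z` of the proximal map is Lipschitz. -/
lemma WeaklyConvexOn.displacement_lipschitz (hf : WeaklyConvexOn Θ ρ f) (hρ : 0 ≤ ρ) (hρ' : ρ < ρ')
    (hp : ∀ z, IsProxPoint Θ f (1 / ρ') z (p z)) (z w : E) :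
    ‖(p z - z) - (p w - w)‖ ≤ ρ' / (ρ' - ρ) * ‖z - w‖ := by
  have h0 : 0 < ρ' - ρ := by linarith
  have hρ0 : 0 < ρ' := by linarith
  have hc := hf.prox_cocoercive hp z w
  set a := p z - p w
  set d := z - w
  have hi := real_inner_le_norm a d
  have e : ‖(p z - z) - (p w - w)‖ ^ 2 = ‖a‖ ^ 2 - 2 * inner ℝ a d + ‖d‖ ^ 2 := by
    rw [show (p z - z) - (p w - w) = a - d by simp only [a, d]; abel, norm_sub_sq_real]
  have ha : (ρ' - ρ) * ‖a‖ ≤ ρ' * ‖d‖ := by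
    rcases (norm_nonneg a).eq_or_lt with h | h
    · rw [← h, mul_zero]; exact mul_nonneg (by linarith) (norm_nonneg _)
    · refine le_of_mul_le_mul_right ?_ h
      nlinarith
  refine abs_le_of_sq_le_sq' ?_ (by positivity) |>.2
  · rw [e, mul_pow, div_pow, div_mul_eq_mul_div, le_div_iff₀ (by positivity)]
    -- cocoercivity bounds the left side by `‖d‖² + (1 - 2 (ρ' - ρ) / ρ') ‖a‖²`
    have hs : ((ρ' - ρ) * ‖a‖) ^ 2 ≤ (ρ' * ‖d‖) ^ 2 := by gcongr
    refine le_of_mul_le_mul_left ?_ hρ0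
    have h3 : ρ' * (‖a‖ ^ 2 - 2 * inner ℝ a d + ‖d‖ ^ 2)
        ≤ (2 * ρ - ρ') * ‖a‖ ^ 2 + ρ' * ‖d‖ ^ 2 := by linarith
    have h4 : (2 * ρ - ρ') * ((ρ' - ρ) * ‖a‖) ^ 2 ≤ ρ * (ρ' * ‖d‖) ^ 2 := by
      nlinarith [sq_nonneg ((ρ' - ρ) * ‖a‖)]
    calc ρ' * ((‖a‖ ^ 2 - 2 * inner ℝ a d + ‖d‖ ^ 2) * (ρ' - ρ) ^ 2)
        = ρ' * (‖a‖ ^ 2 - 2 * inner ℝ a d + ‖d‖ ^ 2) * (ρ' - ρ) ^ 2 := by ring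
      _ ≤ ((2 * ρ - ρ') * ‖a‖ ^ 2 + ρ' * ‖d‖ ^ 2) * (ρ' - ρ) ^ 2 := by gcongr
      _ = (2 * ρ - ρ') * ((ρ' - ρ) * ‖a‖) ^ 2 + ρ' * ‖d‖ ^ 2 * (ρ' - ρ) ^ 2 := by ring
      _ ≤ ρ * (ρ' * ‖d‖) ^ 2 + (ρ' - ρ) * (ρ' * ‖d‖) ^ 2 := by
          refine add_le_add h4 ?_
          have : ρ' * ‖d‖ ^ 2 * (ρ' - ρ) ^ 2 = (ρ' - ρ) * (ρ' * (ρ' - ρ) * ‖d‖ ^ 2) := by ring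
          rw [this]
          refine mul_le_mul_of_nonneg_left ?_ h0.le
          nlinarith [sq_nonneg ‖d‖, mul_nonneg (mul_nonneg hρ hρ0.le) (sq_nonneg ‖d‖)]
      _ = ρ' * (ρ' ^ 2 * ‖d‖ ^ 2) := by ring

/-- The Moreau envelope is differentiable with gradient `ρ' (z - p z)`. -/
lemma WeaklyConvexOn.hasGradientAt_moreauEnvelope [CompleteSpace E] (hf : WeaklyConvexOn Θ ρ f)
    (hfb : BddBelow (f '' Θ)) (hρ : 0 ≤ ρ) (hρ' : ρ < ρ')
    (hp : ∀ z, IsProxPoint Θ f (1 / ρ') z (p z)) (z : E) :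
    HasGradientAt (moreauEnvelope Θ f (1 / ρ')) (ρ' • (z - p z)) z := by
  have hρ0 : 0 < ρ' := by linarith
  have h0 : 0 < ρ' - ρ := by linarith
  have hup : ∀ a b : E, moreauEnvelope Θ f (1 / ρ') b ≤ moreauEnvelope Θ f (1 / ρ') a
      + ρ' * inner ℝ (a - p a) (b - a) + ρ' / 2 * ‖b - a‖ ^ 2 := by
    intro a b
    have h1 := moreauEnvelope_le (z := b) hfb hρ0 (hp a).1
    rw [(hp a).moreauEnvelope_eq hfb hρ0]
    have e : ‖p a - b‖ ^ 2
        = ‖p a - a‖ ^ 2 + 2 * inner ℝ (a - p a) (b - a) + ‖b - a‖ ^ 2 := by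
      rw [show p a - b = (p a - a) - (b - a) by abel, norm_sub_sq_real, ← neg_sub a (p a),
        inner_neg_left, norm_neg]
      ring
    rw [e] at h1
    linarith
  have hbd : ∀ w, ‖moreauEnvelope Θ f (1 / ρ') w - moreauEnvelope Θ f (1 / ρ') z
      - inner ℝ (ρ' • (z - p z)) (w - z)‖ ≤ (ρ' / 2 + ρ' * (ρ' / (ρ' - ρ))) * ‖w - z‖ ^ 2 := by
    intro w
    have h1 := hup z w
    have h2 := hup w z
    have h3 := hf.displacement_lipschitz hρ hρ' hp z w
    have h4 := abs_le.1 (abs_real_inner_le_norm ((p z - z) - (p w - w)) (w - z))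
    have h5 : inner ℝ (w - p w) (z - w)
        = - inner ℝ (z - p z) (w - z) - inner ℝ ((p z - z) - (p w - w)) (w - z) := by
      simp only [inner_sub_left, inner_sub_right]; ring
    have h6 : ‖(p z - z) - (p w - w)‖ * ‖w - z‖ ≤ ρ' / (ρ' - ρ) * ‖w - z‖ ^ 2 := by
      rw [norm_sub_rev z w] at h3
      nlinarith [norm_nonneg (w - z)]
    have h7 : 0 ≤ ρ' * (ρ' / (ρ' - ρ)) * ‖w - z‖ ^ 2 := by positivity
    rw [h5, norm_sub_rev z w] at h2
    rw [Real.norm_eq_abs, inner_smul_left, abs_le]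
    simp only [conj_trivial]
    constructor
    · nlinarith [h4.1, h4.2]
    · linarith
  rw [hasGradientAt_iff_isLittleO]
  refine Asymptotics.IsBigO.trans_isLittleO (g := fun w => ‖w - z‖ ^ 2) ?_ ?_
  · refine Asymptotics.IsBigO.of_bound (ρ' / 2 + ρ' * (ρ' / (ρ' - ρ))) (Eventually.of_forall ?_)
    intro w
    rw [Real.norm_of_nonneg (sq_nonneg ‖w - z‖)]
    exact hbd w
  · have := Asymptotics.isLittleO_pow_sub_sub z (m := 2) one_lt_two
    exact this

/-- A subgradient at `z` makes an obtuse angle with the displacement of the proximal map. -/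
lemma WeaklyConvexOn.inner_displacement_le (hf : WeaklyConvexOn Θ ρ f)
    (hp : ∀ z, IsProxPoint Θ f (1 / ρ') z (p z)) {z v : E} (hz : z ∈ Θ)
    (hv : v ∈ subdifferential Θ f z) :
    inner ℝ v (p z - z) ≤ -((ρ' - ρ) * ‖p z - z‖ ^ 2) := by
  have h1 := hf.subgradient_le hz (hp z).1 hv
  have h2 := hf.prox_growth (hp z) hz
  rw [sub_self, norm_zero, norm_sub_rev z (p z)] at h2
  linarith

lemma WeaklyConvexOn.norm_displacement_le (hf : WeaklyConvexOn Θ ρ f) (hρ' : ρ < ρ')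
    (hp : ∀ z, IsProxPoint Θ f (1 / ρ') z (p z)) {z v : E} {L : ℝ} (hz : z ∈ Θ)
    (hv : v ∈ subdifferential Θ f z) (hvL : ‖v‖ ≤ L) :
    ‖p z - z‖ ≤ L / (ρ' - ρ) := by
  have h1 := hf.inner_displacement_le hp hz hv
  have h2 := (abs_le.1 (abs_real_inner_le_norm v (p z - z))).1
  have h0 : 0 < ρ' - ρ := by linarith
  rw [le_div_iff₀ h0]
  rcases (norm_nonneg (p z - z)).eq_or_lt with h | h
  · rw [← h, zero_mul]; exact (norm_nonneg v).trans hvL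
  · refine le_of_mul_le_mul_right ?_ h
    nlinarith

/-! ### The projection to a closed convex set -/

lemma weaklyConvexOn_zero (hc : Convex ℝ Θ) : WeaklyConvexOn Θ 0 (fun _ => (0 : ℝ)) := by
  simpa [WeaklyConvexOn] using convexOn_const (0 : ℝ) hc

lemma exists_isProj [ProperSpace E] (hΘ : IsClosed Θ) (hne : Θ.Nonempty) (hc : Convex ℝ Θ)
    (z : E) : ∃ y, IsProj Θ z y := by
  simp only [isProj_iff_isProxPoint]
  refine (weaklyConvexOn_zero hc).exists_isProxPoint hΘ hne ?_ ?_ one_pos z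
  · exact ⟨0, by rintro _ ⟨_, _, rfl⟩; exact le_rfl⟩
  · refine fun z _ => ⟨0, fun ε hε => Eventually.of_forall fun θ => ?_⟩
    rw [inner_zero_left]
    have := mul_nonneg (le_of_lt hε) (norm_nonneg (θ - z))
    linarith

lemma IsProj.norm_sub_le (hc : Convex ℝ Θ) {z y w : E} (hy : IsProj Θ z y) (hw : w ∈ Θ) :
    ‖y - w‖ ≤ ‖z - w‖ := by
  have h := (weaklyConvexOn_zero hc).prox_growth (isProj_iff_isProxPoint.1 hy) hw
  refine le_of_sq_le_sq ?_ (norm_nonneg _)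
  rw [norm_sub_rev y w, norm_sub_rev z w]
  nlinarith [sq_nonneg ‖y - z‖]

lemma lipschitzWith_of_isProj (hc : Convex ℝ Θ) {q : E → E} (hq : ∀ z, IsProj Θ z (q z)) :
    LipschitzWith 1 q := by
  refine LipschitzWith.of_dist_le_mul fun z w => ?_
  rw [dist_eq_norm, dist_eq_norm, NNReal.coe_one, one_mul]
  have h := (weaklyConvexOn_zero hc).prox_cocoercive
    (fun z => isProj_iff_isProxPoint.1 (hq z)) z w
  have h2 := real_inner_le_norm (q z - q w) (z - w)
  rcases (norm_nonneg (q z - q w)).eq_or_lt with h0 | h0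
  · rw [← h0]; exact norm_nonneg _
  · refine le_of_mul_le_mul_left ?_ h0
    nlinarith

lemma IsProj.unique (hc : Convex ℝ Θ) {z y y' : E} (hy : IsProj Θ z y) (hy' : IsProj Θ z y') :
    y' = y :=
  (weaklyConvexOn_zero hc).prox_unique one_pos (isProj_iff_isProxPoint.1 hy)
    (isProj_iff_isProxPoint.1 hy')

end Envelope

/-! ### Total variation and conditional distributions -/

section Mixing

variable {X S : Type*} [MeasurableSpace X] [MeasurableSpace S]

lemma tvDist_bddAbove (μ ν : Measure X) [IsProbabilityMeasure μ] [IsProbabilityMeasure ν] :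
    BddAbove (Set.range fun A : {A : Set X // MeasurableSet A} => |μ.real A - ν.real A|) := by
  refine ⟨1, ?_⟩
  rintro _ ⟨A, rfl⟩
  have h1 := measureReal_nonneg (μ := μ) (s := A.1)
  have h2 := measureReal_nonneg (μ := ν) (s := A.1)
  have h3 := measureReal_le_one (μ := μ) (s := A.1)
  have h4 := measureReal_le_one (μ := ν) (s := A.1)
  exact abs_le.2 ⟨by linarith, by linarith⟩

lemma tvDist_le_one (μ ν : Measure X) [IsProbabilityMeasure μ] [IsProbabilityMeasure ν] :
    tvDist μ ν ≤ 1 := by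
  have : Nonempty {A : Set X // MeasurableSet A} := ⟨⟨∅, .empty⟩⟩
  refine ciSup_le fun A => ?_
  have h1 := measureReal_nonneg (μ := μ) (s := A.1)
  have h2 := measureReal_nonneg (μ := ν) (s := A.1)
  have h3 := measureReal_le_one (μ := μ) (s := A.1)
  have h4 := measureReal_le_one (μ := ν) (s := A.1)
  exact abs_le.2 ⟨by linarith, by linarith⟩

lemma tvDist_nonneg (μ ν : Measure X) : 0 ≤ tvDist μ ν :=
  Real.iSup_nonneg fun _ => abs_nonneg _

lemma le_tvDist (μ ν : Measure X) [IsProbabilityMeasure μ] [IsProbabilityMeasure ν] {A : Set X}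
    (hA : MeasurableSet A) : μ.real A - ν.real A ≤ tvDist μ ν :=
  (le_abs_self _).trans (le_ciSup (tvDist_bddAbove μ ν) ⟨A, hA⟩)

/-- Integrals of a function with values in `[-B, B]` differ by at most `2 B` times the total
variation distance: integrate the distribution functions of `u + B` over `[0, 2 B]`. -/
lemma integral_sub_integral_le_tvDist (μ ν : Measure X) [IsProbabilityMeasure μ]
    [IsProbabilityMeasure ν] {u : X → ℝ} (hu : Measurable u) {B : ℝ} (hB : ∀ y, |u y| ≤ B) :
    ∫ y, u y ∂μ - ∫ y, u y ∂ν ≤ 2 * B * tvDist μ ν := by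
  have hint : ∀ (η : Measure X) [IsProbabilityMeasure η], Integrable u η := fun η _ =>
    Integrable.of_bound hu.aestronglyMeasurable B (Eventually.of_forall hB)
  have hB0 : 0 ≤ B := by
    obtain ⟨y⟩ := nonempty_of_isProbabilityMeasure μ
    exact (abs_nonneg _).trans (hB y)
  have hmeas : ∀ (η : Measure X) [IsProbabilityMeasure η],
      AntitoneOn (fun t => η.real {a | t ≤ u a + B}) (Set.Icc 0 (2 * B)) := fun η _ s _ t _ hst =>
    measureReal_mono fun a (ha : t ≤ _) => hst.trans ha
  have hion : ∀ (η : Measure X) [IsProbabilityMeasure η],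
      IntegrableOn (fun t => η.real {a | t ≤ u a + B}) (Set.Ioc 0 (2 * B)) := fun η _ =>
    ((hmeas η).integrableOn_isCompact isCompact_Icc).mono_set Set.Ioc_subset_Icc_self
  have hlc : ∀ (η : Measure X) [IsProbabilityMeasure η],
      ∫ y, u y ∂η = (∫ t in Set.Ioc 0 (2 * B), η.real {a | t ≤ u a + B}) - B := by
    intro η _
    have h := Integrable.integral_eq_integral_Ioc_meas_le (μ := η) (f := fun y => u y + B)
      (M := 2 * B) ((hint η).add (integrable_const B))
      (Eventually.of_forall fun y => by
        have := (abs_le.1 (hB y)).1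
        simp only [Pi.zero_apply]; linarith)
      (Eventually.of_forall fun y => by
        have := (abs_le.1 (hB y)).2
        simp only; linarith)
    rw [integral_add (hint η) (integrable_const B)] at h
    simp only [integral_const, probReal_univ, smul_eq_mul, one_mul] at h
    linarith
  rw [hlc μ, hlc ν, sub_sub_sub_cancel_right, ← integral_sub (hion μ) (hion ν)]
  calc ∫ t in Set.Ioc 0 (2 * B), (μ.real {a | t ≤ u a + B} - ν.real {a | t ≤ u a + B})
      ≤ ∫ _ in Set.Ioc 0 (2 * B), tvDist μ ν := by
        refine integral_mono ((hion μ).sub (hion ν)) (integrable_const _) fun t => ?_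
        exact le_tvDist μ ν (measurableSet_le measurable_const (hu.add_const B))
    _ = 2 * B * tvDist μ ν := by simp [hB0]

lemma mixingTV_nonneg {κ : (m n : ℕ) → Kernel (Finset.Icc 1 m → X) X} {π : Measure X} (m n : ℕ) :
    0 ≤ mixingTV κ π m n :=
  Real.iSup_nonneg fun _ => tvDist_nonneg _ _

variable {κ : (m n : ℕ) → Kernel (Finset.Icc 1 m → X) X} [∀ m n, IsMarkovKernel (κ m n)]
  {π : Measure X} [IsProbabilityMeasure π]

lemma tvDist_le_mixingTV (m n : ℕ) (h : Finset.Icc 1 m → X) :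
    tvDist (κ m n h) π ≤ mixingTV κ π m n := by
  refine le_ciSup (f := fun h => tvDist (κ m n h) π) ⟨1, ?_⟩ h
  rintro _ ⟨h, rfl⟩
  exact tvDist_le_one _ _

lemma mixingTV_le_one (m n : ℕ) : mixingTV κ π m n ≤ 1 := by
  have : Nonempty X := nonempty_of_isProbabilityMeasure π
  exact ciSup_le fun h => tvDist_le_one _ _

/-- Replacing the conditional distribution of `x_n` given the history up to `m` by `π` in an
expectation costs at most `2 B Δ_{[m,n]}`. -/
lemma integral_history_le {P : Measure S} [IsProbabilityMeasure P] {x : ℕ → S → X} {m n : ℕ}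
    (hκ : HasCondDistrib (x n) (history x m) (κ m n) P)
    {H : (Finset.Icc 1 m → X) × X → ℝ} (hH : Measurable H) {B : ℝ} (hB : ∀ q, |H q| ≤ B) :
    ∫ ω, H (history x m ω, x n ω) ∂P ≤
      ∫ ω, (∫ y, H (history x m ω, y) ∂π) ∂P + 2 * B * mixingTV κ π m n := by
  have hm : AEMeasurable (history x m) P := hκ.aemeasurable_fst
  have : IsProbabilityMeasure (P.map (history x m)) := Measure.isProbabilityMeasure_map hm
  have hB0 : 0 ≤ B := by
    obtain ⟨ω⟩ := nonempty_of_isProbabilityMeasure P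
    exact (abs_nonneg _).trans (hB (history x m ω, x n ω))
  have hint : Integrable H (P.map (history x m) ⊗ₘ κ m n) :=
    Integrable.of_bound hH.aestronglyMeasurable B (Eventually.of_forall hB)
  have hint' : Integrable H ((P.map (history x m)).prod π) :=
    Integrable.of_bound hH.aestronglyMeasurable B (Eventually.of_forall hB)
  have hF : AEStronglyMeasurable (fun h => ∫ y, H (h, y) ∂π) (P.map (history x m)) :=
    hint'.integral_prod_left.aestronglyMeasurable
  calc ∫ ω, H (history x m ω, x n ω) ∂P
      = ∫ q, H q ∂(P.map (fun ω => (history x m ω, x n ω))) :=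
        (integral_map hκ.aemeasurable hH.aestronglyMeasurable).symm
    _ = ∫ h, ∫ y, H (h, y) ∂(κ m n h) ∂(P.map (history x m)) := by
        rw [hκ.map_eq, Measure.integral_compProd hint]
    _ ≤ ∫ h, (∫ y, H (h, y) ∂π + 2 * B * mixingTV κ π m n) ∂(P.map (history x m)) := by
        refine integral_mono hint.integral_compProd
          (hint'.integral_prod_left.add (integrable_const _)) fun h => ?_
        have h1 := integral_sub_integral_le_tvDist (κ m n h) π (u := fun y => H (h, y))
          (hH.comp measurable_prodMk_left) (fun y => hB _)
        have h2 := mul_le_mul_of_nonneg_left (tvDist_le_mixingTV (κ := κ) (π := π) m n h)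
          (show 0 ≤ 2 * B by linarith)
        simp only at h1 ⊢
        linarith
    _ = ∫ ω, (∫ y, H (history x m ω, y) ∂π) ∂P + 2 * B * mixingTV κ π m n := by
        rw [integral_add hint'.integral_prod_left (integrable_const _),
          integral_map hm hF]
        simp

end Mixing

/-! ### Iterates of the algorithm -/

section Iterates

variable {E : Type*} [NormedAddCommGroup E] [InnerProductSpace ℝ E]
  {X S : Type*} {Θ : Set E} {G : E → X → E} {α : ℕ → ℝ} {x : ℕ → S → X} {θ₁ : E} {θ : ℕ → S → E}

lemma IsProjectedSGD.mem (hθ : IsProjectedSGD Θ G α x θ₁ θ) {t : ℕ} (ht : 1 ≤ t) (ω : S) :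
    θ t ω ∈ Θ := by
  obtain _ | _ | t := t
  · omega
  · rw [zero_add, hθ.init]; exact hθ.init_mem
  · exact (hθ.step (t + 1) (by omega) ω).1

lemma IsProjectedSGD.norm_step_le (hθ : IsProjectedSGD Θ G α x θ₁ θ) (hc : Convex ℝ Θ)
    (hα : ∀ t, 0 < α t) {L : ℝ} (hGb : ∀ θ ∈ Θ, ∀ y, ‖G θ y‖ ≤ L) {t : ℕ} (ht : 1 ≤ t) (ω : S) :
    ‖θ (t + 1) ω - θ t ω‖ ≤ α t * L := by
  refine ((hθ.step t ht ω).norm_sub_le hc (hθ.mem ht ω)).trans ?_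
  rw [sub_sub_cancel_left, norm_neg, norm_smul, Real.norm_of_nonneg (hα t).le]
  exact mul_le_mul_of_nonneg_left (hGb _ (hθ.mem ht ω) _) (hα t).le

/-- The drift of the iterates over a lag of `k` steps. If the lag reaches back to time `0`,
the deterministic point `θ_1` takes the role of `θ_0`. -/
lemma IsProjectedSGD.norm_drift_le (hθ : IsProjectedSGD Θ G α x θ₁ θ) (hc : Convex ℝ Θ)
    (hα : ∀ t, 0 < α t) (hαm : Antitone α) {L : ℝ} (hL : 0 ≤ L)
    (hGb : ∀ θ ∈ Θ, ∀ y, ‖G θ y‖ ≤ L) (m k : ℕ) (hmk : 1 ≤ m + k) (ω : S) :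
    ‖θ (m + k) ω - θ (max m 1) ω‖ ≤ L * k * α m := by
  induction k with
  | zero =>
    rw [add_zero] at hmk ⊢
    simp [max_eq_left hmk]
  | succ k ih =>
    rcases Nat.eq_zero_or_pos (m + k) with h | h
    · obtain ⟨rfl, rfl⟩ : m = 0 ∧ k = 0 := by omega
      have := (hα 0).le
      simp only [zero_add, Nat.zero_le, sup_of_le_right, sub_self, norm_zero]
      positivity
    · have h1 := ih h
      have h2 := hθ.norm_step_le hc hα hGb h ω
      have h3 : α (m + k) * L ≤ α m * L :=
        mul_le_mul_of_nonneg_right (hαm (Nat.le_add_right m k)) hL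
      rw [← add_assoc, show θ (m + k + 1) ω - θ (max m 1) ω
        = (θ (m + k + 1) ω - θ (m + k) ω) + (θ (m + k) ω - θ (max m 1) ω) by abel]
      refine (norm_add_le _ _).trans ?_
      push_cast
      linarith

variable [MeasurableSpace X] [ProperSpace E] [MeasurableSpace E] [BorelSpace E]

/-- `G` is jointly measurable after its first argument is projected to `Θ`: it is then
continuous in the first argument and measurable in the second. -/
lemma measurable_uncurry_comp_proj (hc : Convex ℝ Θ) {q : E → E} (hq : ∀ z, IsProj Θ z (q z))
    (hGm : ∀ θ ∈ Θ, Measurable (G θ)) {L₁ : ℝ}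
    (hGl : ∀ y, ∀ θ ∈ Θ, ∀ θ' ∈ Θ, ‖G θ y - G θ' y‖ ≤ L₁ * ‖θ - θ'‖) :
    Measurable (Function.uncurry fun z y => G (q z) y) := by
  refine measurable_uncurry_of_continuous_of_measurable (fun y => ?_) fun z => hGm _ (hq z).1
  have hl : LipschitzOnWith L₁.toNNReal (fun z => G z y) Θ :=
    LipschitzOnWith.of_dist_le_mul fun z hz w hw => by
      rw [dist_eq_norm, dist_eq_norm]
      exact (hGl y z hz w hw).trans
        (mul_le_mul_of_nonneg_right (Real.le_coe_toNNReal L₁) (norm_nonneg _))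
  exact hl.continuousOn.comp_continuous (lipschitzWith_of_isProj hc hq).continuous fun z => (hq z).1

/-- The iterate at time `m` (at time `1` if `m = 0`) is a measurable function of the history up
to time `m`. -/
lemma IsProjectedSGD.exists_measurable_history (hθ : IsProjectedSGD Θ G α x θ₁ θ)
    (hΘ : IsClosed Θ) (hc : Convex ℝ Θ)
    (hGm : ∀ θ ∈ Θ, Measurable (G θ)) {L₁ : ℝ}
    (hGl : ∀ y, ∀ θ ∈ Θ, ∀ θ' ∈ Θ, ‖G θ y - G θ' y‖ ≤ L₁ * ‖θ - θ'‖) (m : ℕ) :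
    ∃ F : (Finset.Icc 1 m → X) → E, Measurable F ∧ (∀ h, F h ∈ Θ) ∧
      ∀ ω, θ (max m 1) ω = F (history x m ω) := by
  choose q hq using exists_isProj hΘ ⟨θ₁, hθ.init_mem⟩ hc
  induction m with
  | zero => exact ⟨fun _ => θ₁, measurable_const, fun _ => hθ.init_mem, fun ω => hθ.init ω⟩
  | succ m ih =>
    rcases Nat.eq_zero_or_pos m with rfl | hm
    · exact ⟨fun _ => θ₁, measurable_const, fun _ => hθ.init_mem, fun ω => hθ.init ω⟩
    obtain ⟨F, hFm, hFΘ, hF⟩ := ih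
    let r : (Finset.Icc 1 (m + 1) → X) → (Finset.Icc 1 m → X) := fun h i =>
      h ⟨i, Finset.mem_Icc.2 ⟨(Finset.mem_Icc.1 i.2).1, by have := (Finset.mem_Icc.1 i.2).2; omega⟩⟩
    have hr : Measurable r := measurable_pi_lambda _ fun i => measurable_pi_apply _
    let e : (Finset.Icc 1 (m + 1) → X) → X := fun h =>
      h ⟨m + 1, Finset.mem_Icc.2 ⟨by omega, le_rfl⟩⟩
    have he : Measurable e := measurable_pi_apply _
    have hG := measurable_uncurry_comp_proj hc hq hGm hGl
    refine ⟨fun h => q (F (r h) - α m • G (q (F (r h))) (e h)), ?_, fun h => (hq _).1, fun ω => ?_⟩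
    · refine (lipschitzWith_of_isProj hc hq).continuous.measurable.comp ?_
      exact (hFm.comp hr).sub ((hG.comp ((hFm.comp hr).prodMk he)).const_smul (α m))
    · have hFr : F (r (history x (m + 1) ω)) = θ m ω := by
        have h := hF ω
        rw [max_eq_left (show 1 ≤ m from hm)] at h
        exact h.symm
      have hqF : q (θ m ω) = θ m ω := by
        refine IsProj.unique hc ⟨hθ.mem hm ω, fun w _ => ?_⟩ (hq _)
        rw [sub_self, norm_zero]; exact norm_nonneg _
      rw [max_eq_left (by omega)]
      simp only [hFr, hqF]
      exact IsProj.unique hc (hq _) (hθ.step m hm ω)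

end Iterates

/-! ### The expected descent inequality -/

section Oracle

variable {E : Type*} [NormedAddCommGroup E] [InnerProductSpace ℝ E]
  {X S : Type*} [MeasurableSpace X]

/-- The standing assumptions on the problem: `f` is `ρ`-weakly convex and bounded below on the
closed set `Θ`, and `G` is a stochastic subgradient that is unbiased under `π`, `L₁`-Lipschitz
in the parameter and bounded by `L`. -/
structure IsOracle [MeasurableSpace E] (Θ : Set E) (f : E → ℝ) (ρ : ℝ) (π : Measure X)
    (G : E → X → E) (L₁ L : ℝ) : Prop where
  isClosed : IsClosed Θ
  nonempty : Θ.Nonempty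
  rho_pos : 0 < ρ
  weaklyConvexOn : WeaklyConvexOn Θ ρ f
  bddBelow : BddBelow (f '' Θ)
  measurable : ∀ θ ∈ Θ, Measurable (G θ)
  unbiased : ∀ θ ∈ Θ, ∫ y, G θ y ∂π ∈ subdifferential Θ f θ
  lipschitz_pos : 0 < L₁
  lipschitz : ∀ y, ∀ θ ∈ Θ, ∀ θ' ∈ Θ, ‖G θ y - G θ' y‖ ≤ L₁ * ‖θ - θ'‖
  bound_pos : 0 < L
  bound : ∀ θ ∈ Θ, ∀ y, ‖G θ y‖ ≤ L

variable {Θ : Set E} {f : E → ℝ} {ρ ρ' : ℝ} {π : Measure X} {G : E → X → E}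
  {L₁ L : ℝ} {p : E → E} [MeasurableSpace E]

lemma IsOracle.exists_isProxPoint [ProperSpace E] (h : IsOracle Θ f ρ π G L₁ L) (hρ' : ρ < ρ')
    (z : E) : ∃ y, IsProxPoint Θ f (1 / ρ') z y :=
  h.weaklyConvexOn.exists_isProxPoint h.isClosed h.nonempty h.bddBelow
    (fun z hz => ⟨_, h.unbiased z hz⟩) (h.rho_pos.trans hρ') z

section

variable [IsProbabilityMeasure π]

lemma IsOracle.norm_mean_le (h : IsOracle Θ f ρ π G L₁ L) {z : E} (hz : z ∈ Θ) :
    ‖∫ y, G z y ∂π‖ ≤ L := by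
  simpa using norm_integral_le_of_norm_le_const (μ := π) (Eventually.of_forall (h.bound z hz))

lemma IsOracle.norm_displacement_le (h : IsOracle Θ f ρ π G L₁ L) (hρ' : ρ < ρ')
    (hp : ∀ z, IsProxPoint Θ f (1 / ρ') z (p z)) {z : E} (hz : z ∈ Θ) :
    ‖p z - z‖ ≤ L / (ρ' - ρ) :=
  h.weaklyConvexOn.norm_displacement_le hρ' hp hz (h.unbiased z hz) (h.norm_mean_le hz)

lemma IsOracle.abs_inner_le (h : IsOracle Θ f ρ π G L₁ L) (hρ' : ρ < ρ')
    (hp : ∀ z, IsProxPoint Θ f (1 / ρ') z (p z)) {z : E} (hz : z ∈ Θ) (y : X) :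
    |(inner ℝ (p z - z) (G z y) : ℝ)| ≤ L ^ 2 / (ρ' - ρ) := by
  refine (abs_real_inner_le_norm _ _).trans ?_
  have h1 := h.norm_displacement_le hρ' hp hz
  have := mul_le_mul h1 (h.bound z hz y) (norm_nonneg _) ((norm_nonneg _).trans h1)
  refine this.trans_eq ?_
  ring

/-- The pairing of the displacement of the proximal map with a vector field that is bounded by `L`
and `L₁`-Lipschitz is Lipschitz. -/
lemma IsOracle.inner_displacement_sub_le (h : IsOracle Θ f ρ π G L₁ L) (hρ' : ρ < ρ')
    (hp : ∀ z, IsProxPoint Θ f (1 / ρ') z (p z)) {z w a b : E} (hw : w ∈ Θ)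
    (ha : ‖a‖ ≤ L) (hab : ‖a - b‖ ≤ L₁ * ‖z - w‖) :
    inner ℝ (p z - z) a - inner ℝ (p w - w) b ≤ L * (L₁ + ρ') / (ρ' - ρ) * ‖z - w‖ := by
  have h0 : 0 < ρ' - ρ := by linarith
  have h1 := h.weaklyConvexOn.displacement_lipschitz h.rho_pos.le hρ' hp z w
  have h2 := h.norm_displacement_le hρ' hp hw
  have e : inner ℝ (p z - z) a - inner ℝ (p w - w) b
      = inner ℝ ((p z - z) - (p w - w)) a + inner ℝ (p w - w) (a - b) := by
    rw [inner_sub_left (p z - z), inner_sub_right (p w - w)]; ring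
  have hL := h.bound_pos
  have h3 : ‖(p z - z) - (p w - w)‖ * ‖a‖ ≤ ρ' / (ρ' - ρ) * ‖z - w‖ * L :=
    mul_le_mul h1 ha (norm_nonneg _) ((norm_nonneg _).trans h1)
  have h4 : ‖p w - w‖ * ‖a - b‖ ≤ L / (ρ' - ρ) * (L₁ * ‖z - w‖) :=
    mul_le_mul h2 hab (norm_nonneg _) ((norm_nonneg _).trans h2)
  rw [e]
  calc _ ≤ ρ' / (ρ' - ρ) * ‖z - w‖ * L + L / (ρ' - ρ) * (L₁ * ‖z - w‖) :=
        add_le_add ((real_inner_le_norm _ _).trans h3) ((real_inner_le_norm _ _).trans h4)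
    _ = _ := by ring

end

lemma IsOracle.continuous_displacement (h : IsOracle Θ f ρ π G L₁ L) (hρ' : ρ < ρ')
    (hp : ∀ z, IsProxPoint Θ f (1 / ρ') z (p z)) : Continuous fun z => p z - z := by
  have h0 : 0 < ρ' - ρ := by linarith
  refine (LipschitzWith.of_dist_le_mul (K := (ρ' / (ρ' - ρ)).toNNReal) fun z w => ?_).continuous
  rw [dist_eq_norm, dist_eq_norm]
  exact (h.weaklyConvexOn.displacement_lipschitz h.rho_pos.le hρ' hp z w).trans
    (mul_le_mul_of_nonneg_right (Real.le_coe_toNNReal _) (norm_nonneg _))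

variable {α : ℕ → ℝ} {x : ℕ → S → X} {θ₁ : E} {θ : ℕ → S → E}

/-- Decrease of the Moreau envelope in one step: compare with the proximal point of `θ_t`. -/
lemma IsOracle.envelope_step (h : IsOracle Θ f ρ π G L₁ L) (hρ' : ρ < ρ')
    (hp : ∀ z, IsProxPoint Θ f (1 / ρ') z (p z)) (hθ : IsProjectedSGD Θ G α x θ₁ θ)
    {t : ℕ} (ht : 1 ≤ t) (ω : S) :
    moreauEnvelope Θ f (1 / ρ') (θ (t + 1) ω) ≤ moreauEnvelope Θ f (1 / ρ') (θ t ω)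
      + ρ' * (α t * inner ℝ (p (θ t ω) - θ t ω) (G (θ t ω) (x (t + 1) ω)))
      + ρ' / 2 * L ^ 2 * α t ^ 2 := by
  have hρ0 : 0 < ρ' := h.rho_pos.trans hρ'
  set z := θ t ω
  set v := G z (x (t + 1) ω)
  have h1 := moreauEnvelope_le (z := θ (t + 1) ω) h.bddBelow hρ0 (hp z).1
  have h2 := (hθ.step t ht ω).norm_sub_le h.weaklyConvexOn.1 (hp z).1
  rw [(hp z).moreauEnvelope_eq h.bddBelow hρ0]
  have h3 : ‖p z - θ (t + 1) ω‖ ^ 2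
      ≤ ‖p z - z‖ ^ 2 + 2 * (α t * inner ℝ (p z - z) v) + α t ^ 2 * ‖v‖ ^ 2 := by
    rw [norm_sub_rev]
    refine (pow_le_pow_left₀ (norm_nonneg _) h2 2).trans_eq ?_
    rw [norm_sub_rev, show p z - (z - α t • v) = (p z - z) + α t • v by abel, norm_add_sq_real,
      inner_smul_right, norm_smul, mul_pow, Real.norm_eq_abs, sq_abs]
  have h4 : ‖v‖ ^ 2 ≤ L ^ 2 := pow_le_pow_left₀ (norm_nonneg _) (h.bound _ (hθ.mem ht ω) _) 2
  have h5 := mul_le_mul_of_nonneg_left h4 (sq_nonneg (α t))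
  nlinarith

/-- Summing the decrease of the Moreau envelope along a path. -/
lemma IsOracle.envelope_sum (h : IsOracle Θ f ρ π G L₁ L) (hρ' : ρ < ρ')
    (hp : ∀ z, IsProxPoint Θ f (1 / ρ') z (p z)) (hθ : IsProjectedSGD Θ G α x θ₁ θ)
    (T : ℕ) (ω : S) :
    ρ' * ∑ t ∈ Finset.Icc 1 T, α t * -inner ℝ (p (θ t ω) - θ t ω) (G (θ t ω) (x (t + 1) ω)) ≤
      moreauEnvelope Θ f (1 / ρ') θ₁ - (⨅ z, moreauEnvelope Θ f (1 / ρ') z)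
        + ρ' / 2 * L ^ 2 * ∑ t ∈ Finset.Icc 1 T, α t ^ 2 := by
  have hρ0 : 0 < ρ' := h.rho_pos.trans hρ'
  have key : ρ' * ∑ t ∈ Finset.Icc 1 T,
        α t * -inner ℝ (p (θ t ω) - θ t ω) (G (θ t ω) (x (t + 1) ω)) ≤
      moreauEnvelope Θ f (1 / ρ') θ₁ - moreauEnvelope Θ f (1 / ρ') (θ (T + 1) ω)
        + ρ' / 2 * L ^ 2 * ∑ t ∈ Finset.Icc 1 T, α t ^ 2 := by
    induction T with
    | zero => simp [hθ.init]
    | succ T ih =>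
      have := h.envelope_step hρ' hp hθ (show 1 ≤ T + 1 by omega) ω
      rw [Finset.sum_Icc_succ_top (by omega), Finset.sum_Icc_succ_top (by omega), mul_add, mul_add]
      linarith
  obtain ⟨b, hb⟩ := h.bddBelow
  have hinf : (⨅ z, moreauEnvelope Θ f (1 / ρ') z)
      ≤ moreauEnvelope Θ f (1 / ρ') (θ (T + 1) ω) := by
    refine ciInf_le ⟨b, ?_⟩ _
    rintro _ ⟨z, rfl⟩
    have h1 := hb ⟨p z, (hp z).1, rfl⟩
    have h2 : 0 ≤ ρ' / 2 * ‖p z - z‖ ^ 2 := by positivity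
    simp only [(hp z).moreauEnvelope_eq h.bddBelow hρ0]
    linarith
  linarith

variable [MeasurableSpace S] [ProperSpace E] [BorelSpace E]

lemma IsOracle.measurable_iterate (h : IsOracle Θ f ρ π G L₁ L)
    (hθ : IsProjectedSGD Θ G α x θ₁ θ) (hx : ∀ n, 1 ≤ n → Measurable (x n)) {t : ℕ} (ht : 1 ≤ t) :
    Measurable (θ t) := by
  obtain ⟨F, hF, -, hFθ⟩ := hθ.exists_measurable_history h.isClosed h.weaklyConvexOn.1
    h.measurable h.lipschitz t
  rw [max_eq_left ht] at hFθ
  rw [show θ t = fun ω => F (history x t ω) from funext hFθ]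
  exact hF.comp (measurable_pi_lambda _ fun i => hx _ (Finset.mem_Icc.1 i.2).1)

/-- Measurability of the pairing of the displacement of the proximal map with the oracle, along
measurable parameters in `Θ`. -/
lemma IsOracle.measurable_inner (h : IsOracle Θ f ρ π G L₁ L) (hρ' : ρ < ρ')
    (hp : ∀ z, IsProxPoint Θ f (1 / ρ') z (p z)) {Q : Type*} [MeasurableSpace Q] {F : Q → E}
    {Y : Q → X} (hF : Measurable F) (hFΘ : ∀ a, F a ∈ Θ) (hY : Measurable Y) :
    Measurable fun a => (inner ℝ (p (F a) - F a) (G (F a) (Y a)) : ℝ) := by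
  choose q hq using exists_isProj h.isClosed h.nonempty h.weaklyConvexOn.1
  have hqF : ∀ a, q (F a) = F a := fun a => by
    refine IsProj.unique h.weaklyConvexOn.1 ⟨hFΘ a, fun w _ => ?_⟩ (hq _)
    rw [sub_self, norm_zero]; exact norm_nonneg _
  have hG := (measurable_uncurry_comp_proj h.weaklyConvexOn.1 hq h.measurable h.lipschitz).comp
    (hF.prodMk hY)
  simp only [Function.comp_def, Function.uncurry, hqF] at hG
  exact ((h.continuous_displacement hρ' hp).measurable.comp hF).inner hG

variable [IsProbabilityMeasure π] {P : Measure S} [IsProbabilityMeasure P]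
  {κ : (m n : ℕ) → Kernel (Finset.Icc 1 m → X) X} [∀ m n, IsMarkovKernel (κ m n)]

lemma IsOracle.integrable_displacement_sq (h : IsOracle Θ f ρ π G L₁ L) (hρ' : ρ < ρ')
    (hp : ∀ z, IsProxPoint Θ f (1 / ρ') z (p z)) (hθ : IsProjectedSGD Θ G α x θ₁ θ)
    (hx : ∀ n, 1 ≤ n → Measurable (x n)) {t : ℕ} (ht : 1 ≤ t) :
    Integrable (fun ω => ‖p (θ t ω) - θ t ω‖ ^ 2) P := by
  refine Integrable.of_bound (C := (L / (ρ' - ρ)) ^ 2) ?_ (Eventually.of_forall fun ω => ?_)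
  · exact (((h.continuous_displacement hρ' hp).measurable.comp
      (h.measurable_iterate hθ hx ht)).norm.pow_const 2).aestronglyMeasurable
  · rw [Real.norm_of_nonneg (sq_nonneg _)]
    exact pow_le_pow_left₀ (norm_nonneg _) (h.norm_displacement_le hρ' hp (hθ.mem ht ω)) 2

lemma IsOracle.integrable_inner (h : IsOracle Θ f ρ π G L₁ L) (hρ' : ρ < ρ')
    (hp : ∀ z, IsProxPoint Θ f (1 / ρ') z (p z)) (hθ : IsProjectedSGD Θ G α x θ₁ θ)
    (hx : ∀ n, 1 ≤ n → Measurable (x n)) {t : ℕ} (ht : 1 ≤ t) :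
    Integrable (fun ω => (inner ℝ (p (θ t ω) - θ t ω) (G (θ t ω) (x (t + 1) ω)) : ℝ)) P :=
  Integrable.of_bound (h.measurable_inner hρ' hp (h.measurable_iterate hθ hx ht)
    (hθ.mem ht) (hx _ (by omega))).aestronglyMeasurable (L ^ 2 / (ρ' - ρ))
    (Eventually.of_forall fun ω => h.abs_inner_le hρ' hp (hθ.mem ht ω) _)

/-- The pairing of the displacement with the stochastic subgradient is negative in expectation, up
to the drift of the iterates over `k` steps and the mixing error. The oracle at `θ_{m+k}` is
compared with the one at `θ_m`, where conditioning on the history up to `m` nearly gives the mean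
under `π`; the mean is then carried back to `θ_{m+k}`. -/
lemma IsOracle.expected_inner_le (h : IsOracle Θ f ρ π G L₁ L) (hρ' : ρ < ρ')
    (hp : ∀ z, IsProxPoint Θ f (1 / ρ') z (p z)) (hθ : IsProjectedSGD Θ G α x θ₁ θ)
    (hx : ∀ n, 1 ≤ n → Measurable (x n))
    (hκ : ∀ m n, m < n → HasCondDistrib (x n) (history x m) (κ m n) P)
    (hα : ∀ t, 0 < α t) (hαm : Antitone α) (m k : ℕ) (hmk : 1 ≤ m + k) :
    (ρ' - ρ) * ∫ ω, ‖p (θ (m + k) ω) - θ (m + k) ω‖ ^ 2 ∂P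
        + ∫ ω, inner ℝ (p (θ (m + k) ω) - θ (m + k) ω) (G (θ (m + k) ω) (x (m + k + 1) ω)) ∂P ≤
      2 * L ^ 2 * (L₁ + ρ') / (ρ' - ρ) * (k * α m)
        + 2 * L ^ 2 / (ρ' - ρ) * mixingTV κ π m (m + k + 1) := by
  have h0 : 0 < ρ' - ρ := by linarith
  have hρ0 := h.rho_pos
  have hL₁ := h.lipschitz_pos
  have hL := h.bound_pos
  obtain ⟨F, hFm, hFΘ, hF⟩ := hθ.exists_measurable_history h.isClosed h.weaklyConvexOn.1
    h.measurable h.lipschitz m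
  have hhist : Measurable (history x m) :=
    measurable_pi_lambda _ fun i => hx _ (Finset.mem_Icc.1 i.2).1
  set c := L * (L₁ + ρ') / (ρ' - ρ) with hc
  set d := L * k * α m with hd
  have hc0 : 0 ≤ c := by rw [hc]; apply div_nonneg _ h0.le; apply mul_nonneg hL.le; linarith
  have hdrift : ∀ ω, ‖θ (m + k) ω - F (history x m ω)‖ ≤ d := fun ω => by
    rw [← hF ω]
    exact hθ.norm_drift_le h.weaklyConvexOn.1 hα hαm hL.le h.bound m k hmk ω
  let H : (Finset.Icc 1 m → X) × X → ℝ := fun q => inner ℝ (p (F q.1) - F q.1) (G (F q.1) q.2)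
  have hH : Measurable H := h.measurable_inner hρ' hp (hFm.comp measurable_fst)
    (fun _ => hFΘ _) measurable_snd
  have hHB : ∀ q, |H q| ≤ L ^ 2 / (ρ' - ρ) := fun q => h.abs_inner_le hρ' hp (hFΘ _) _
  have hHint : ∀ (η : Measure S) [IsProbabilityMeasure η], Integrable
      (fun ω => H (history x m ω, x (m + k + 1) ω)) η := fun η _ =>
    Integrable.of_bound (hH.comp (hhist.prodMk (hx _ (by omega)))).aestronglyMeasurable _
      (Eventually.of_forall fun ω => hHB _)
  have hGint : ∀ z ∈ Θ, Integrable (G z) π := fun z hz =>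
    Integrable.of_bound (h.measurable z hz).aestronglyMeasurable L
      (Eventually.of_forall (h.bound z hz))
  have hmean : ∀ a, ∫ y, H (a, y) ∂π = inner ℝ (p (F a) - F a) (∫ y, G (F a) y ∂π) :=
    fun a => integral_inner (𝕜 := ℝ) (hGint _ (hFΘ a)) (p (F a) - F a)
  have hmeanlip : ∀ z ∈ Θ, ∀ w ∈ Θ,
      ‖∫ y, G z y ∂π - ∫ y, G w y ∂π‖ ≤ L₁ * ‖z - w‖ := fun z hz w hw => by
    rw [← integral_sub (hGint z hz) (hGint w hw)]
    simpa using norm_integral_le_of_norm_le_const (μ := π)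
      (Eventually.of_forall fun y => h.lipschitz y z hz w hw)
  have hmeanint : Integrable (fun ω => ∫ y, H (history x m ω, y) ∂π) P := by
    refine Integrable.of_bound (C := L ^ 2 / (ρ' - ρ)) ?_ (Eventually.of_forall fun ω => ?_)
    · exact ((hH.stronglyMeasurable.integral_prod_right' (ν := π)).measurable.comp
        hhist).aestronglyMeasurable
    · simpa using norm_integral_le_of_norm_le_const (μ := π)
        (Eventually.of_forall fun y => (Real.norm_eq_abs _).trans_le (hHB (history x m ω, y)))
  have hDint := h.integrable_displacement_sq (P := P) hρ' hp hθ hx hmk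
  have h1 : ∫ ω, inner ℝ (p (θ (m + k) ω) - θ (m + k) ω)
        (G (θ (m + k) ω) (x (m + k + 1) ω)) ∂P ≤
      ∫ ω, H (history x m ω, x (m + k + 1) ω) ∂P + c * d := by
    rw [show c * d = ∫ _, c * d ∂P by simp, ← integral_add (hHint P) (integrable_const _)]
    refine integral_mono (h.integrable_inner hρ' hp hθ hx hmk)
      ((hHint P).add (integrable_const _)) fun ω => ?_
    have h2 := h.inner_displacement_sub_le hρ' hp (hFΘ (history x m ω))
      (h.bound _ (hθ.mem hmk ω) (x (m + k + 1) ω))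
      (h.lipschitz (x (m + k + 1) ω) _ (hθ.mem hmk ω) _ (hFΘ (history x m ω)))
    have h3 := mul_le_mul_of_nonneg_left (hdrift ω) hc0
    simp only [H]
    linarith
  have h2 := integral_history_le (π := π) (hκ m (m + k + 1) (by omega)) hH hHB
  have h3 : ∫ ω, (∫ y, H (history x m ω, y) ∂π) ∂P ≤
      c * d - (ρ' - ρ) * ∫ ω, ‖p (θ (m + k) ω) - θ (m + k) ω‖ ^ 2 ∂P := by
    rw [← integral_const_mul, show c * d = ∫ _, c * d ∂P by simp,
      ← integral_sub (integrable_const _) (hDint.const_mul _)]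
    refine integral_mono hmeanint ((integrable_const _).sub (hDint.const_mul _)) fun ω => ?_
    have h2 := h.inner_displacement_sub_le hρ' hp (hθ.mem hmk ω)
      (h.norm_mean_le (hFΘ (history x m ω)))
      (hmeanlip _ (hFΘ (history x m ω)) _ (hθ.mem hmk ω))
    have h3 := h.weaklyConvexOn.inner_displacement_le hp (hθ.mem hmk ω)
      (h.unbiased _ (hθ.mem hmk ω))
    rw [real_inner_comm] at h3
    have h4 := mul_le_mul_of_nonneg_left (hdrift ω) hc0
    rw [norm_sub_rev] at h2
    simp only [hmean]
    linarith
  have e : 2 * L ^ 2 * (L₁ + ρ') / (ρ' - ρ) * (k * α m) = 2 * (c * d) := by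
    rw [hc, hd]; ring
  have e2 : 2 * L ^ 2 / (ρ' - ρ) = 2 * (L ^ 2 / (ρ' - ρ)) := by ring
  rw [e, e2]
  linarith

/-- The weighted sum of the expected squared gradient norms `ρ'² ‖p θ_t - θ_t‖²`, for any lags
`k_t ≤ t`. -/
lemma IsOracle.sum_expected_le (h : IsOracle Θ f ρ π G L₁ L) (hρ' : ρ < ρ')
    (hp : ∀ z, IsProxPoint Θ f (1 / ρ') z (p z)) (hθ : IsProjectedSGD Θ G α x θ₁ θ)
    (hx : ∀ n, 1 ≤ n → Measurable (x n))
    (hκ : ∀ m n, m < n → HasCondDistrib (x n) (history x m) (κ m n) P)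
    (hα : ∀ t, 0 < α t) (hαm : Antitone α) {k : ℕ → ℕ} {T : ℕ} (hk : ∀ t, 1 ≤ t → k t ≤ t) :
    ∑ t ∈ Finset.Icc 1 T, α t * ∫ ω, (ρ' * ‖p (θ t ω) - θ t ω‖) ^ 2 ∂P ≤
      ρ' ^ 2 * L ^ 2 / (ρ' - ρ) *
        ((moreauEnvelope Θ f (1 / ρ') θ₁ - ⨅ z, moreauEnvelope Θ f (1 / ρ') z) / (ρ' * L ^ 2)
          + 1 / 2 * ∑ t ∈ Finset.Icc 1 T, α t ^ 2
          + 2 * (L₁ + ρ') / (ρ' - ρ) * ∑ t ∈ Finset.Icc 1 T, (k t : ℝ) * α t * α (t - k t)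
          + 2 / (ρ' - ρ) * ∑ t ∈ Finset.Icc 1 T, α t * mixingTV κ π (t - k t) (t + 1)) := by
  have h0 : 0 < ρ' - ρ := by linarith
  have hρ0 : 0 < ρ' := h.rho_pos.trans hρ'
  have hL := h.bound_pos
  -- the pathwise bound, integrated
  have h1 : ρ' * ∑ t ∈ Finset.Icc 1 T,
        α t * -∫ ω, inner ℝ (p (θ t ω) - θ t ω) (G (θ t ω) (x (t + 1) ω)) ∂P ≤
      moreauEnvelope Θ f (1 / ρ') θ₁ - (⨅ z, moreauEnvelope Θ f (1 / ρ') z)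
        + ρ' / 2 * L ^ 2 * ∑ t ∈ Finset.Icc 1 T, α t ^ 2 := by
    have hint : ∀ t ∈ Finset.Icc 1 T, Integrable (fun ω =>
        α t * -inner ℝ (p (θ t ω) - θ t ω) (G (θ t ω) (x (t + 1) ω))) P := fun t ht =>
      (h.integrable_inner hρ' hp hθ hx (Finset.mem_Icc.1 ht).1).neg.const_mul _
    have e : ∑ t ∈ Finset.Icc 1 T,
        α t * -∫ ω, inner ℝ (p (θ t ω) - θ t ω) (G (θ t ω) (x (t + 1) ω)) ∂P
        = ∫ ω, ∑ t ∈ Finset.Icc 1 T,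
          α t * -inner ℝ (p (θ t ω) - θ t ω) (G (θ t ω) (x (t + 1) ω)) ∂P := by
      rw [integral_finsetSum _ hint]
      exact Finset.sum_congr rfl fun t _ => by rw [integral_const_mul, integral_neg]
    rw [e, ← integral_const_mul]
    have hmono := integral_mono ((integrable_finsetSum _ hint).const_mul ρ')
      (integrable_const (μ := P) _) (fun ω => h.envelope_sum hρ' hp hθ T ω)
    simpa using hmono
  have h2 : ∑ t ∈ Finset.Icc 1 T, α t * ((ρ' - ρ) * ∫ ω, ‖p (θ t ω) - θ t ω‖ ^ 2 ∂P) ≤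
      ∑ t ∈ Finset.Icc 1 T,
        (α t * -∫ ω, inner ℝ (p (θ t ω) - θ t ω) (G (θ t ω) (x (t + 1) ω)) ∂P
        + (2 * L ^ 2 * (L₁ + ρ') / (ρ' - ρ) * ((k t : ℝ) * α t * α (t - k t))
        + 2 * L ^ 2 / (ρ' - ρ) * (α t * mixingTV κ π (t - k t) (t + 1)))) := by
    refine Finset.sum_le_sum fun t ht => ?_
    have ht1 := (Finset.mem_Icc.1 ht).1
    have h3 := h.expected_inner_le hρ' hp hθ hx hκ hα hαm (t - k t) (k t)
      (by have := hk t ht1; omega)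
    rw [Nat.sub_add_cancel (hk t ht1)] at h3
    have h4 := mul_le_mul_of_nonneg_left h3 (hα t).le
    linarith
  rw [Finset.sum_add_distrib, Finset.sum_add_distrib, ← Finset.mul_sum, ← Finset.mul_sum] at h2
  have e1 : ∑ t ∈ Finset.Icc 1 T, α t * ∫ ω, (ρ' * ‖p (θ t ω) - θ t ω‖) ^ 2 ∂P
      = ρ' / (ρ' - ρ) * (ρ' * ∑ t ∈ Finset.Icc 1 T,
        α t * ((ρ' - ρ) * ∫ ω, ‖p (θ t ω) - θ t ω‖ ^ 2 ∂P)) := by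
    rw [Finset.mul_sum, Finset.mul_sum]
    refine Finset.sum_congr rfl fun t _ => ?_
    simp only [mul_pow]
    rw [integral_const_mul]
    field_simp
  rw [e1]
  have h3 := mul_le_mul_of_nonneg_left h2 hρ0.le
  rw [mul_add] at h3
  have h4 := mul_le_mul_of_nonneg_left (h3.trans (add_le_add h1 le_rfl))
    (show 0 ≤ ρ' / (ρ' - ρ) by positivity)
  refine h4.trans_eq ?_
  field_simp
  ring

end Oracle

/-! ### The two output rules -/

section Output

variable {E X S : Type*} [MeasurableSpace S] {P : Measure S} [IsProbabilityMeasure P]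
  {α : ℕ → ℝ} {x : ℕ → S → X} {θ : ℕ → S → E} {g : E → ℝ} {M : ℝ} {T : ℕ} {out : S → E}

lemma sum_Icc_pos (hα : ∀ t, 0 < α t) (hT : 1 ≤ T) : 0 < ∑ t ∈ Finset.Icc 1 T, α t :=
  Finset.sum_pos (fun t _ => hα t) ⟨1, Finset.mem_Icc.2 ⟨le_rfl, hT⟩⟩

/-- The best iterate: `g` at the output is the minimum of `g` over the iterates, which is bounded
by any weighted average. -/
lemma IsBestOutput.integral_le (hout : IsBestOutput g θ T out) (hT : 1 ≤ T) (hα : ∀ t, 0 < α t)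
    (hg0 : ∀ z, 0 ≤ g z) (hgM : ∀ t, 1 ≤ t → ∀ ω, g (θ t ω) ≤ M)
    (hgm : ∀ t, 1 ≤ t → Measurable fun ω => g (θ t ω)) :
    AEStronglyMeasurable (fun ω => g (out ω)) P ∧ (∀ᵐ ω ∂P, g (out ω) ≤ M) ∧
      ∫ ω, g (out ω) ^ 2 ∂P ≤
        1 / (∑ t ∈ Finset.Icc 1 T, α t) * ∑ t ∈ Finset.Icc 1 T, α t * ∫ ω, g (θ t ω) ^ 2 ∂P := by
  have hne : (Finset.Icc 1 T).Nonempty := ⟨1, Finset.mem_Icc.2 ⟨le_rfl, hT⟩⟩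
  have hle : ∀ t ∈ Finset.Icc 1 T, ∀ ω, g (out ω) ≤ g (θ t ω) := fun t ht ω =>
    le_of_sq_le_sq ((hout ω).2 t ht) (hg0 _)
  have heq : (fun ω => g (out ω)) = (Finset.Icc 1 T).inf' hne (fun t ω => g (θ t ω)) := by
    funext ω
    rw [Finset.inf'_apply]
    refine le_antisymm (Finset.le_inf' _ _ fun t ht => hle t ht ω) ?_
    obtain ⟨t, ht, e⟩ := (hout ω).1
    rw [e]
    exact Finset.inf'_le (fun t => g (θ t ω)) ht
  have hmeas : Measurable (fun ω => g (out ω)) := by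
    rw [heq]
    exact Finset.inf'_induction hne _ (fun u hu v hv => Measurable.inf hu hv)
      fun t ht => hgm t (Finset.mem_Icc.1 ht).1
  have hM : ∀ ω, g (out ω) ≤ M := fun ω =>
    (hle 1 (Finset.mem_Icc.2 ⟨le_rfl, hT⟩) ω).trans (hgM 1 le_rfl ω)
  refine ⟨hmeas.aestronglyMeasurable, Eventually.of_forall hM, ?_⟩
  have hint : ∀ u : S → ℝ, Measurable u → (∀ ω, 0 ≤ u ω) → (∀ ω, u ω ≤ M) →
      Integrable (fun ω => u ω ^ 2) P := fun u hu h0 h1 =>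
    Integrable.of_bound (hu.pow_const 2).aestronglyMeasurable (M ^ 2) (Eventually.of_forall fun ω =>
      by rw [Real.norm_of_nonneg (sq_nonneg _)]; exact pow_le_pow_left₀ (h0 ω) (h1 ω) 2)
  have hS := sum_Icc_pos hα hT
  rw [one_div, ← div_eq_inv_mul, le_div_iff₀ hS, mul_comm, Finset.sum_mul]
  refine Finset.sum_le_sum fun t ht => mul_le_mul_of_nonneg_left ?_ (hα t).le
  have ht1 := (Finset.mem_Icc.1 ht).1
  exact integral_mono (hint _ hmeas (fun ω => hg0 _) hM)
    (hint _ (hgm t ht1) (fun ω => hg0 _) (hgM t ht1))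
    fun ω => pow_le_pow_left₀ (hg0 _) (hle t ht ω) 2

variable [MeasurableSpace X]

/-- The randomized output: independence of `τ` and the data turns the expectation into the
weighted average. -/
lemma IsRandomOutput.integral_le (hout : IsRandomOutput P x α θ T out) (hT : 1 ≤ T)
    (hα : ∀ t, 0 < α t) (hg0 : ∀ z, 0 ≤ g z) (hgM : ∀ t, 1 ≤ t → ∀ ω, g (θ t ω) ≤ M)
    (hgm : ∀ t, 1 ≤ t → ∃ Ψ : (ℕ → X) → ℝ, Measurable Ψ ∧
      ∀ ω, g (θ t ω) = Ψ (fun n => x (n + 1) ω))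
    (hx : ∀ n, 1 ≤ n → Measurable (x n)) :
    AEStronglyMeasurable (fun ω => g (out ω)) P ∧ (∀ᵐ ω ∂P, g (out ω) ≤ M) ∧
      ∫ ω, g (out ω) ^ 2 ∂P ≤
        1 / (∑ t ∈ Finset.Icc 1 T, α t) * ∑ t ∈ Finset.Icc 1 T, α t * ∫ ω, g (θ t ω) ^ 2 ∂P := by
  obtain ⟨τ, hτ, hind, hprob, ho⟩ := hout
  have hS := sum_Icc_pos hα hT
  have hτj : ∀ j, MeasurableSet {ω | τ ω = j} := fun j => hτ (measurableSet_singleton j)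
  have hmem : ∀ᵐ ω ∂P, τ ω ∈ Finset.Icc 1 T := by
    have h1 : P.real (⋃ j ∈ Finset.Icc 1 T, {ω | τ ω = j}) = 1 := by
      rw [measureReal_biUnion_finset]
      · rw [Finset.sum_congr rfl hprob, ← Finset.sum_div, div_self hS.ne']
      · intro i _ j _ hij
        exact Set.disjoint_left.2 fun ω (hi : τ ω = i) (hj : τ ω = j) => hij (hi.symm.trans hj)
      · exact fun j _ => hτj j
    have h2 : P (⋃ j ∈ Finset.Icc 1 T, {ω | τ ω = j}) = 1 := by
      rw [← ENNReal.toReal_eq_one_iff]; exact h1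
    have h3 := (mem_ae_iff_prob_eq_one
      (Finset.measurableSet_biUnion _ fun j _ => hτj j)).2 h2
    filter_upwards [h3] with ω hω
    simp only [Set.mem_iUnion] at hω
    obtain ⟨j, hj, e⟩ := hω
    exact (show τ ω = j from e) ▸ hj
  have hdata : Measurable fun ω (n : ℕ) => x (n + 1) ω :=
    measurable_pi_lambda _ fun n => hx _ (by omega)
  have hgθ : ∀ t, 1 ≤ t → Measurable fun ω => g (θ t ω) := fun t ht => by
    obtain ⟨Ψ, hΨ, e⟩ := hgm t ht
    simp only [e]
    exact hΨ.comp hdata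
  have hsum : ∀ u : ℝ → ℝ, (fun ω => u (g (out ω))) =ᵐ[P] fun ω => ∑ j ∈ Finset.Icc 1 T,
      ({j} : Set ℕ).indicator 1 (τ ω) * u (g (θ j ω)) := fun u => by
    filter_upwards [hmem] with ω hω
    rw [Finset.sum_eq_single_of_mem (τ ω) hω, ho]
    · simp
    · intro j _ hj
      rw [Set.indicator_of_notMem (by simpa using Ne.symm hj), zero_mul]
  have hind1 : ∀ j, Measurable (({j} : Set ℕ).indicator (1 : ℕ → ℝ)) := fun j =>
    measurable_from_top
  refine ⟨?_, ?_, ?_⟩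
  · refine AEStronglyMeasurable.congr ?_ (hsum id).symm
    refine (Finset.measurable_fun_sum _ fun j hj => ?_).aestronglyMeasurable
    exact ((hind1 j).comp hτ).mul (hgθ j (Finset.mem_Icc.1 hj).1)
  · filter_upwards [hmem] with ω hω
    rw [ho]
    exact hgM _ (Finset.mem_Icc.1 hω).1 ω
  · have hint : ∀ j ∈ Finset.Icc 1 T, Integrable (fun ω =>
        ({j} : Set ℕ).indicator 1 (τ ω) * g (θ j ω) ^ 2) P := fun j hj => by
      have hj1 := (Finset.mem_Icc.1 hj).1
      refine Integrable.of_bound (((hind1 j).comp hτ).mul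
        ((hgθ j hj1).pow_const 2)).aestronglyMeasurable (M ^ 2) (Eventually.of_forall fun ω => ?_)
      have h1 := pow_le_pow_left₀ (hg0 _) (hgM j hj1 ω) 2
      by_cases hω : τ ω = j
      · simpa [hω] using h1
      · have : (0 : ℝ) ≤ M ^ 2 := sq_nonneg M
        simpa [hω] using this
    rw [integral_congr_ae (hsum fun r => r ^ 2), integral_finsetSum _ hint, Finset.mul_sum]
    refine le_of_eq (Finset.sum_congr rfl fun j hj => ?_)
    obtain ⟨Ψ, hΨ, e⟩ := hgm j (Finset.mem_Icc.1 hj).1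
    have h1 := (hind.comp (hind1 j) (hΨ.pow_const 2)).integral_fun_mul_eq_mul_integral
      ((hind1 j).comp hτ).aestronglyMeasurable
      ((hΨ.pow_const 2).comp hdata).aestronglyMeasurable
    simp only [Function.comp_def, ← e] at h1
    rw [h1]
    have h2 : ∫ ω, ({j} : Set ℕ).indicator (1 : ℕ → ℝ) (τ ω) ∂P
        = α j / ∑ t ∈ Finset.Icc 1 T, α t := by
      rw [← hprob j hj, ← integral_indicator_one (hτj j)]
      rfl
    rw [h2]
    ring

end Output

section Rate

variable {E : Type*} [NormedAddCommGroup E] [InnerProductSpace ℝ E] [ProperSpace E]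
  [MeasurableSpace E] [BorelSpace E]
  {X S : Type*} [MeasurableSpace X] [MeasurableSpace S]
  {Θ : Set E} {f : E → ℝ} {ρ ρ' : ℝ} {π : Measure X} [IsProbabilityMeasure π] {G : E → X → E}
  {L₁ L : ℝ} {p : E → E} {α : ℕ → ℝ} {x : ℕ → S → X} {θ₁ : E} {θ : ℕ → S → E}
  {P : Measure S} [IsProbabilityMeasure P]
  {κ : (m n : ℕ) → Kernel (Finset.Icc 1 m → X) X} [∀ m n, IsMarkovKernel (κ m n)]

/-- For either output rule, the gradient norm at the output is bounded and measurable, and its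
second moment is at most the weighted average over the iterates. -/
lemma IsOracle.output_le (h : IsOracle Θ f ρ π G L₁ L) (hρ' : ρ < ρ')
    (hp : ∀ z, IsProxPoint Θ f (1 / ρ') z (p z)) (hθ : IsProjectedSGD Θ G α x θ₁ θ)
    (hx : ∀ n, 1 ≤ n → Measurable (x n)) (hα : ∀ t, 0 < α t)
    {g : E → ℝ} (hg : ∀ z, g z = ρ' * ‖p z - z‖) {T : ℕ} (hT : 1 ≤ T) {out : S → E}
    (hout : IsRandomOutput P x α θ T out ∨ IsBestOutput g θ T out) :
    Integrable (fun ω => g (out ω)) P ∧ Integrable (fun ω => g (out ω) ^ 2) P ∧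
      ∫ ω, g (out ω) ^ 2 ∂P ≤
        1 / (∑ t ∈ Finset.Icc 1 T, α t) * ∑ t ∈ Finset.Icc 1 T, α t * ∫ ω, g (θ t ω) ^ 2 ∂P := by
  have hρ0 : 0 < ρ' := h.rho_pos.trans hρ'
  have hg0 : ∀ z, 0 ≤ g z := fun z => by rw [hg]; positivity
  have hgM : ∀ t, 1 ≤ t → ∀ ω, g (θ t ω) ≤ ρ' * (L / (ρ' - ρ)) := fun t ht ω => by
    rw [hg]
    exact mul_le_mul_of_nonneg_left (h.norm_displacement_le hρ' hp (hθ.mem ht ω)) hρ0.le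
  have hgc : Measurable g := by
    rw [show g = fun z => ρ' * ‖p z - z‖ from funext hg]
    exact ((h.continuous_displacement hρ' hp).norm.const_mul ρ').measurable
  have key : AEStronglyMeasurable (fun ω => g (out ω)) P ∧
      (∀ᵐ ω ∂P, g (out ω) ≤ ρ' * (L / (ρ' - ρ))) ∧
      ∫ ω, g (out ω) ^ 2 ∂P ≤
        1 / (∑ t ∈ Finset.Icc 1 T, α t) * ∑ t ∈ Finset.Icc 1 T, α t * ∫ ω, g (θ t ω) ^ 2 ∂P := by
    rcases hout with hout | hout
    · refine hout.integral_le hT hα hg0 hgM (fun t ht => ?_) hx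
      obtain ⟨F, hF, -, hFθ⟩ := hθ.exists_measurable_history h.isClosed h.weaklyConvexOn.1
        h.measurable h.lipschitz t
      rw [max_eq_left ht] at hFθ
      refine ⟨fun w => g (F fun i => w (i - 1)), hgc.comp (hF.comp
        (measurable_pi_lambda _ fun i => measurable_pi_apply _)), fun ω => ?_⟩
      rw [hFθ]
      congr 2
      funext i
      have := (Finset.mem_Icc.1 i.2).1
      simp only [history]
      rw [Nat.sub_add_cancel this]
    · exact hout.integral_le hT hα hg0 hgM
        fun t ht => hgc.comp (h.measurable_iterate hθ hx ht)
  obtain ⟨h1, h2, h3⟩ := key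
  refine ⟨Integrable.of_bound h1 (ρ' * (L / (ρ' - ρ))) ?_, Integrable.of_bound (h1.pow 2)
    ((ρ' * (L / (ρ' - ρ))) ^ 2) ?_, h3⟩
  · filter_upwards [h2] with ω hω
    rwa [Real.norm_of_nonneg (hg0 _)]
  · filter_upwards [h2] with ω hω
    rw [Real.norm_of_nonneg (sq_nonneg _)]
    exact pow_le_pow_left₀ (hg0 _) hω 2

end Rate

/-! ### Sample complexity -/

section Complexity

lemma sum_Icc_sub_const (u : ℕ → ℝ) (K T : ℕ) :
    ∑ t ∈ Finset.Icc 1 T, u (t - K) = (min T K : ℕ) * u 0 + ∑ s ∈ Finset.Icc 1 (T - K), u s := by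
  induction T with
  | zero => simp
  | succ T ih =>
    rw [Finset.sum_Icc_succ_top (by omega), ih]
    rcases Nat.lt_or_ge T K with hT | hT
    · rw [show T + 1 - K = 0 by omega, show T - K = 0 by omega, min_eq_left hT.le,
        min_eq_left (show T + 1 ≤ K by omega)]
      push_cast
      ring
    · rw [show T + 1 - K = T - K + 1 by omega, min_eq_right hT,
        min_eq_right (show K ≤ T + 1 by omega), Finset.sum_Icc_succ_top (by omega)]
      ring

/-- If `T ≥ K ε⁻⁴ (1 + log (1/ε))⁴` then `1 + log T` is small compared with `ε T^{1/4}`. -/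
lemma exists_log_le_fourth_root {N : ℝ} (hN : 1 ≤ N) : ∃ K : ℝ, ∀ ε : ℝ, 0 < ε → ε ≤ 1 →
    ∀ T : ℝ, 1 ≤ T → K * (1 / ε) ^ 4 * (1 + Real.log (1 / ε)) ^ 4 ≤ T →
      N * (1 + Real.log T) ≤ ε * Real.sqrt (Real.sqrt T) := by
  -- With `M = s²` and `log M ≤ 2 s`, the final estimate asks for `N (12 + 8 s) ≤ s²`, which
  -- `s = 21 N` satisfies.
  refine ⟨((21 * N) ^ 2) ^ 4, fun ε hε hε1 T hT hKT => ?_⟩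
  set u := 1 / ε with hu
  set l := 1 + Real.log u with hl
  set y := Real.sqrt (Real.sqrt T) with hy
  set M := (21 * N) ^ 2 with hM
  have hu1 : 1 ≤ u := by rw [hu, le_div_iff₀ hε]; linarith
  have hl1 : 1 ≤ l := by have := Real.log_nonneg hu1; linarith
  have hM0 : 0 < M := by positivity
  have hy4 : y ^ 4 = T := by
    rw [show y ^ 4 = (y ^ 2) ^ 2 by ring, hy, Real.sq_sqrt (Real.sqrt_nonneg _),
      Real.sq_sqrt (by linarith)]
  have hy0 : 0 ≤ y := Real.sqrt_nonneg _
  have hMul : M * u * l ≤ y := by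
    refine le_of_pow_le_pow_left₀ (n := 4) (by norm_num) hy0 ?_
    rw [hy4, mul_pow, mul_pow]
    exact hKT
  have hMul0 : 0 < M * u * l := by positivity
  -- the excess of `T^{1/4}` over its lower bound
  set w := y / (M * u * l) with hw
  have hw1 : 1 ≤ w := by rw [hw, le_div_iff₀ hMul0]; linarith
  have hyw : y = M * u * l * w := by rw [hw]; field_simp
  have hlogT : Real.log T = 4 * (Real.log M + Real.log u + Real.log l + Real.log w) := by
    rw [← hy4, Real.log_pow, hyw, Real.log_mul (by positivity) (by positivity),
      Real.log_mul (by positivity) (by positivity), Real.log_mul (by positivity) (by positivity)]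
    norm_num
  have h1 : Real.log M ≤ 42 * N := by
    rw [hM, Real.log_pow]
    have := Real.log_le_sub_one_of_pos (show 0 < 21 * N by linarith)
    push_cast
    linarith
  have h2 := Real.log_le_sub_one_of_pos (show 0 < l by linarith)
  have h3 := Real.log_le_sub_one_of_pos (show 0 < w by linarith)
  have hlw : 1 ≤ l * w := one_le_mul_of_one_le_of_one_le hl1 hw1
  have h4 : l ≤ l * w := le_mul_of_one_le_right (by linarith) hw1
  have h5 : w ≤ l * w := le_mul_of_one_le_left (by linarith) hl1
  have h6 : 1 + Real.log T ≤ 180 * N * (l * w) := by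
    have : N ≤ N * (l * w) := le_mul_of_one_le_right (by linarith) hlw
    have : l * w ≤ N * (l * w) := le_mul_of_one_le_left (by linarith) hN
    rw [hlogT]
    linarith
  calc N * (1 + Real.log T) ≤ N * (180 * N * (l * w)) := by gcongr
    _ ≤ M * (l * w) := by
        rw [hM]
        nlinarith [mul_nonneg (sq_nonneg N) (show 0 ≤ l * w by linarith)]
    _ = ε * y := by rw [hyw, hu]; field_simp

variable {α : ℕ → ℝ} {c : ℝ}

lemma sum_sq_le_log (hα : ∀ t : ℕ, 1 ≤ t → α t = c / Real.sqrt t) (T : ℕ) :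
    ∑ t ∈ Finset.Icc 1 T, α t ^ 2 ≤ c ^ 2 * (1 + Real.log T) := by
  have h := harmonic_le_one_add_log T
  rw [harmonic_eq_sum_Icc] at h
  push_cast at h
  refine le_trans (le_of_eq ?_) (mul_le_mul_of_nonneg_left h (sq_nonneg c))
  rw [Finset.mul_sum]
  refine Finset.sum_congr rfl fun t ht => ?_
  rw [hα t (Finset.mem_Icc.1 ht).1, div_pow, Real.sq_sqrt (Nat.cast_nonneg t), div_eq_mul_inv]

lemma mul_sqrt_le_sum (hc : 0 < c) (hα : ∀ t : ℕ, 1 ≤ t → α t = c / Real.sqrt t) (T : ℕ) :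
    c * Real.sqrt T ≤ ∑ t ∈ Finset.Icc 1 T, α t := by
  rcases Nat.eq_zero_or_pos T with rfl | hT
  · simp
  have hT0 : (0 : ℝ) < T := Nat.cast_pos.2 hT
  have h : ∀ t ∈ Finset.Icc 1 T, c / Real.sqrt T ≤ α t := fun t ht => by
    obtain ⟨h1, h2⟩ := Finset.mem_Icc.1 ht
    rw [hα t h1]
    have : (0 : ℝ) < t := Nat.cast_pos.2 h1
    have := Real.sqrt_pos.2 this
    gcongr
  have h2 := Finset.card_nsmul_le_sum _ _ _ h
  rw [Nat.card_Icc, Nat.add_sub_cancel, nsmul_eq_mul] at h2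
  refine le_trans (le_of_eq ?_) h2
  have := Real.sqrt_pos.2 hT0
  field_simp
  rw [Real.sq_sqrt hT0.le]

variable {E : Type*} [NormedAddCommGroup E] [InnerProductSpace ℝ E] [ProperSpace E]
  [MeasurableSpace E] [BorelSpace E]
  {X S : Type*} [MeasurableSpace X] [MeasurableSpace S]
  {Θ : Set E} {f : E → ℝ} {ρ ρ' : ℝ} {π : Measure X} [IsProbabilityMeasure π] {G : E → X → E}
  {L₁ L : ℝ} {p : E → E} {x : ℕ → S → X} {θ₁ : E} {θ : ℕ → S → E}
  {P : Measure S} [IsProbabilityMeasure P]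
  {κ : (m n : ℕ) → Kernel (Finset.Icc 1 m → X) X} [∀ m n, IsMarkovKernel (κ m n)]

/-- For step sizes `c / √t` and exponentially mixing data the weighted sum of the expected squared
gradient norms is `O(log² T)`. The lags `k_t = min (t, K)`, with `K` a large multiple of `log T`,
make the mixing error `O(1 / T)` after the first `K` steps. -/
lemma IsOracle.sum_expected_le_log_sq (h : IsOracle Θ f ρ π G L₁ L) (hρ' : ρ < ρ')
    (hp : ∀ z, IsProxPoint Θ f (1 / ρ') z (p z)) (hθ : IsProjectedSGD Θ G α x θ₁ θ)
    (hx : ∀ n, 1 ≤ n → Measurable (x n))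
    (hκ : ∀ m n, m < n → HasCondDistrib (x n) (history x m) (κ m n) P)
    (hα : ∀ t, 0 < α t) (hαm : Antitone α)
    (hαc : ∀ t : ℕ, 1 ≤ t → α t = c / Real.sqrt t) (hmix : ExponentiallyMixing κ π) :
    ∃ M : ℝ, ∀ T : ℕ, 1 ≤ T →
      ∑ t ∈ Finset.Icc 1 T, α t * ∫ ω, (ρ' * ‖p (θ t ω) - θ t ω‖) ^ 2 ∂P ≤
        M * (1 + Real.log T) ^ 2 := by
  obtain ⟨C, r, hr0, hr1, hC⟩ := hmix
  have h0 : 0 < ρ' - ρ := by linarith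
  have hρ0 : 0 < ρ' := h.rho_pos.trans hρ'
  have hL := h.bound_pos
  have hL₁ := h.lipschitz_pos
  have hC0 : 0 ≤ C := by
    have h1 := (mixingTV_nonneg (κ := κ) (π := π) 1 2).trans (hC 1 2 le_rfl (by norm_num))
    rw [show 2 - 1 = 1 from rfl, pow_one] at h1
    exact nonneg_of_mul_nonneg_left h1 hr0
  have hlr : 0 < -Real.log r := neg_pos.2 (Real.log_neg hr0 hr1)
  set a := 1 / -Real.log r with ha
  have ha0 : 0 < a := by positivity
  have hα0 := (hα 0).le
  set B := (moreauEnvelope Θ f (1 / ρ') θ₁ - ⨅ z, moreauEnvelope Θ f (1 / ρ') z) / (ρ' * L ^ 2)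
  refine ⟨ρ' ^ 2 * L ^ 2 / (ρ' - ρ) * (|B| + 1 / 2 * c ^ 2
    + 2 * (L₁ + ρ') / (ρ' - ρ) * ((a + 1) * ((a + 1) * α 0 ^ 2 + c ^ 2))
    + 2 / (ρ' - ρ) * (α 0 * ((a + 1) + C))), fun T hT => ?_⟩
  have hT0 : (0 : ℝ) < T := Nat.cast_pos.2 hT
  set l := 1 + Real.log T with hl
  have hl1 : 1 ≤ l := by have := Real.log_natCast_nonneg T; linarith
  have hll : l ≤ l ^ 2 := by nlinarith
  set K := ⌈a * Real.log T⌉₊ with hK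
  have hKl : (K : ℝ) ≤ (a + 1) * l := by
    have h1 := (Nat.ceil_lt_add_one (mul_nonneg ha0.le (Real.log_natCast_nonneg T))).le
    nlinarith
  have hrK : r ^ (K + 1) ≤ 1 / T := by
    have h1 : a * Real.log T ≤ K := Nat.le_ceil _
    have h2 : Real.log T ≤ K * -Real.log r := by
      rw [ha, div_mul_eq_mul_div, one_mul, div_le_iff₀ hlr] at h1; exact h1
    have h3 : r ^ K ≤ 1 / T := by
      rw [← Real.log_le_log_iff (by positivity) (by positivity), Real.log_pow, one_div,
        Real.log_inv]
      linarith
    exact (pow_le_pow_of_le_one hr0.le hr1.le (Nat.le_succ K)).trans h3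
  have hsq := sum_sq_le_log hαc
  have hsub : ∀ t, t - min t K = t - K := fun t => by omega
  have h1 := h.sum_expected_le (P := P) (κ := κ) hρ' hp hθ hx hκ hα hαm (k := fun t => min t K)
    (T := T) (fun t _ => min_le_left _ _)
  simp only [hsub] at h1
  have hminK : ((min T K : ℕ) : ℝ) ≤ K := Nat.cast_le.2 (min_le_right _ _)
  -- the drift term
  have h2 : ∑ t ∈ Finset.Icc 1 T, ((min t K : ℕ) : ℝ) * α t * α (t - K) ≤
      (a + 1) * ((a + 1) * α 0 ^ 2 + c ^ 2) * l ^ 2 := by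
    have h3 : ∑ t ∈ Finset.Icc 1 T, α (t - K) ^ 2 ≤ K * α 0 ^ 2 + c ^ 2 * l := by
      rw [sum_Icc_sub_const (fun s => α s ^ 2)]
      refine add_le_add (mul_le_mul_of_nonneg_right hminK (sq_nonneg _)) (le_trans ?_ (hsq T))
      exact Finset.sum_le_sum_of_subset_of_nonneg
        (Finset.Icc_subset_Icc le_rfl (Nat.sub_le _ _)) fun _ _ _ => sq_nonneg _
    calc ∑ t ∈ Finset.Icc 1 T, ((min t K : ℕ) : ℝ) * α t * α (t - K)
        ≤ ∑ t ∈ Finset.Icc 1 T, (K : ℝ) * α (t - K) ^ 2 := by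
          refine Finset.sum_le_sum fun t _ => ?_
          have h4 : ((min t K : ℕ) : ℝ) ≤ K := Nat.cast_le.2 (min_le_right _ _)
          have h5 : α t ≤ α (t - K) := hαm (Nat.sub_le _ _)
          have h6 := (hα t).le
          have h7 := (hα (t - K)).le
          rw [mul_assoc, sq]
          gcongr
      _ = K * ∑ t ∈ Finset.Icc 1 T, α (t - K) ^ 2 := by rw [Finset.mul_sum]
      _ ≤ ((a + 1) * l) * (((a + 1) * l) * α 0 ^ 2 + c ^ 2 * l) := by
          have h8 : (K : ℝ) * α 0 ^ 2 ≤ ((a + 1) * l) * α 0 ^ 2 := by gcongr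
          refine mul_le_mul hKl (h3.trans (by linarith))
            (Finset.sum_nonneg fun _ _ => sq_nonneg _) (by positivity)
      _ = _ := by ring
  -- the mixing term
  have h3 : ∑ t ∈ Finset.Icc 1 T, α t * mixingTV κ π (t - K) (t + 1) ≤
      α 0 * ((a + 1) + C) * l ^ 2 := by
    let u : ℕ → ℝ := fun s => if s = 0 then 1 else C / T
    have hu : ∀ t ∈ Finset.Icc 1 T, mixingTV κ π (t - K) (t + 1) ≤ u (t - K) := fun t ht => by
      by_cases ht0 : t - K = 0
      · simp only [u, ht0, if_true]; exact mixingTV_le_one _ _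
      · simp only [u, ht0, if_false]
        refine (hC _ _ (by omega) (by omega)).trans ?_
        rw [show t + 1 - (t - K) = K + 1 by omega, div_eq_mul_one_div]
        exact mul_le_mul_of_nonneg_left hrK hC0
    have hu0 : ∀ s, 0 ≤ u s := fun s => by simp only [u]; split_ifs <;> positivity
    have husum : ∑ t ∈ Finset.Icc 1 T, u (t - K) ≤ K + C := by
      rw [sum_Icc_sub_const]
      refine add_le_add (by simp [u]) ?_
      calc ∑ s ∈ Finset.Icc 1 (T - K), u s ≤ ∑ s ∈ Finset.Icc 1 T, u s :=
            Finset.sum_le_sum_of_subset_of_nonneg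
              (Finset.Icc_subset_Icc le_rfl (Nat.sub_le _ _)) fun s _ _ => hu0 s
        _ = ∑ s ∈ Finset.Icc 1 T, C / T := Finset.sum_congr rfl fun s hs => by
            have := (Finset.mem_Icc.1 hs).1
            simp only [u, show s ≠ 0 by omega, if_false]
        _ = C := by
            rw [Finset.sum_const, Nat.card_Icc, Nat.add_sub_cancel, nsmul_eq_mul]
            field_simp
    calc ∑ t ∈ Finset.Icc 1 T, α t * mixingTV κ π (t - K) (t + 1)
        ≤ ∑ t ∈ Finset.Icc 1 T, α 0 * u (t - K) := Finset.sum_le_sum fun t ht =>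
          mul_le_mul (hαm (Nat.zero_le t)) (hu t ht) (mixingTV_nonneg _ _) hα0
      _ = α 0 * ∑ t ∈ Finset.Icc 1 T, u (t - K) := by rw [Finset.mul_sum]
      _ ≤ α 0 * (((a + 1) + C) * l ^ 2) := by
          refine mul_le_mul_of_nonneg_left (husum.trans ?_) hα0
          nlinarith
      _ = _ := by ring
  have h4 : |B| ≤ |B| * l ^ 2 := le_mul_of_one_le_right (abs_nonneg _) (hl1.trans hll)
  have h5 : c ^ 2 * l ≤ c ^ 2 * l ^ 2 := mul_le_mul_of_nonneg_left hll (sq_nonneg _)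
  have h6 := mul_le_mul_of_nonneg_left h2 (show 0 ≤ 2 * (L₁ + ρ') / (ρ' - ρ) by positivity)
  have h7 := mul_le_mul_of_nonneg_left h3 (show 0 ≤ 2 / (ρ' - ρ) by positivity)
  refine h1.trans ?_
  rw [mul_assoc (ρ' ^ 2 * L ^ 2 / (ρ' - ρ))]
  refine mul_le_mul_of_nonneg_left ?_ (by positivity)
  have h8 := hsq T
  have h9 := le_abs_self B
  linarith

/-- Sample complexity `Õ(ε⁻⁴)` for step sizes `c / √t` and exponentially mixing data. -/
lemma IsOracle.sample_complexity (h : IsOracle Θ f ρ π G L₁ L) (hρ' : ρ < ρ')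
    (hp : ∀ z, IsProxPoint Θ f (1 / ρ') z (p z)) (hθ : IsProjectedSGD Θ G α x θ₁ θ)
    (hx : ∀ n, 1 ≤ n → Measurable (x n))
    (hκ : ∀ m n, m < n → HasCondDistrib (x n) (history x m) (κ m n) P)
    (hα : ∀ t, 0 < α t) (hαm : Antitone α) (hc : 0 < c)
    (hαc : ∀ t : ℕ, 1 ≤ t → α t = c / Real.sqrt t) (hmix : ExponentiallyMixing κ π)
    {g : E → ℝ} (hg : ∀ z, g z = ρ' * ‖p z - z‖) :
    ∃ (K : ℝ) (q : ℕ), ∀ ε : ℝ, 0 < ε → ε ≤ 1 →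
      ∀ T : ℕ, 1 ≤ T → K * (1 / ε) ^ 4 * (1 + Real.log (1 / ε)) ^ q ≤ T →
        ∀ out : S → E, (IsRandomOutput P x α θ T out ∨ IsBestOutput g θ T out) →
          Integrable (fun ω => g (out ω)) P ∧ ∫ ω, g (out ω) ∂P ≤ ε := by
  obtain ⟨M, hM⟩ := h.sum_expected_le_log_sq hρ' hp hθ hx hκ hα hαm hαc hmix
  obtain ⟨K, hK⟩ := exists_log_le_fourth_root (N := max 1 (M / c)) (le_max_left _ _)
  refine ⟨K, 4, fun ε hε hε1 T hT hKT out hout => ?_⟩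
  have hT1 : (1 : ℝ) ≤ T := Nat.one_le_cast.2 hT
  obtain ⟨hi, hi2, hle⟩ := h.output_le hρ' hp hθ hx hα hg hT hout
  refine ⟨hi, ?_⟩
  have hN := hK ε hε hε1 T hT1 hKT
  set N := max 1 (M / c)
  have hN1 : 1 ≤ N := le_max_left _ _
  have hlog := Real.log_natCast_nonneg T
  have hsT : 0 < Real.sqrt T := Real.sqrt_pos.2 (by linarith)
  have hsq : ∫ ω, g (out ω) ^ 2 ∂P ≤ ε ^ 2 := by
    have h1 := hM T hT
    simp only [← hg] at h1
    have hS := mul_sqrt_le_sum hc hαc T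
    have hS0 := sum_Icc_pos hα hT
    refine hle.trans ?_
    rw [one_div, ← div_eq_inv_mul, div_le_iff₀ hS0]
    have h2 : (N * (1 + Real.log T)) ^ 2 ≤ (ε * Real.sqrt (Real.sqrt T)) ^ 2 :=
      pow_le_pow_left₀ (by positivity) hN 2
    rw [mul_pow, mul_pow, Real.sq_sqrt (Real.sqrt_nonneg _)] at h2
    have h3 : M ≤ c * N ^ 2 := by
      have h4 : M / c ≤ N := le_max_right _ _
      rw [div_le_iff₀ hc] at h4
      have h5 : N ≤ N ^ 2 := by nlinarith
      nlinarith [mul_le_mul_of_nonneg_left h5 hc.le]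
    calc _ ≤ M * (1 + Real.log T) ^ 2 := h1
      _ ≤ c * N ^ 2 * (1 + Real.log T) ^ 2 := by gcongr
      _ = c * (N ^ 2 * (1 + Real.log T) ^ 2) := by ring
      _ ≤ c * (ε ^ 2 * Real.sqrt T) := by gcongr
      _ = ε ^ 2 * (c * Real.sqrt T) := by ring
      _ ≤ _ := by gcongr
  -- `g ≤ g² / (2 ε) + ε / 2` passes from the second to the first moment
  have hmono : ∫ ω, g (out ω) ∂P ≤ ∫ ω, (1 / (2 * ε) * g (out ω) ^ 2 + ε / 2) ∂P := by
    refine integral_mono hi ((hi2.const_mul _).add (integrable_const _)) fun ω => ?_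
    have : 1 / (2 * ε) * g (out ω) ^ 2 + ε / 2 - g (out ω) = (g (out ω) - ε) ^ 2 / (2 * ε) := by
      field_simp; ring
    have h2 : 0 ≤ (g (out ω) - ε) ^ 2 / (2 * ε) := by positivity
    simp only
    linarith
  rw [integral_add (hi2.const_mul _) (integrable_const _), integral_const_mul] at hmono
  simp only [integral_const, probReal_univ, smul_eq_mul, one_mul] at hmono
  have h5 := mul_le_mul_of_nonneg_left hsq (show 0 ≤ 1 / (2 * ε) by positivity)
  have h6 : 1 / (2 * ε) * ε ^ 2 = ε / 2 := by field_simp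
  linarith

end Complexity

/-! ### Almost sure convergence -/

/-- If `∑ α_t u_t < ∞`, `∑ α_t = ∞` and `∑ α_t² < ∞`, and the increments of `u ≥ 0` are `O(α_t)`,
then `u → 0`: the increments of `u²` are summable, so that `u` converges, and no limit other than
`0` is possible. -/
lemma tendsto_zero_of_summable_mul {α u : ℕ → ℝ} {K : ℝ} (hα : ∀ t, 0 < α t) (hu : ∀ t, 0 ≤ u t)
    (hαu : Summable fun t => α t * u t) (hα1 : ¬ Summable α) (hα2 : Summable fun t => α t ^ 2)
    (hK : ∀ t, |u (t + 1) - u t| ≤ K * α t) : Tendsto u atTop (𝓝 0) := by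
  have hinc : Summable fun t => dist (u t ^ 2) (u (t + 1) ^ 2) := by
    refine Summable.of_nonneg_of_le (fun _ => dist_nonneg) (fun t => ?_)
      ((hαu.mul_left (2 * K)).add (hα2.mul_left (K ^ 2)))
    have h1 := hK t
    have h2 : u (t + 1) ≤ u t + K * α t := by linarith [(abs_le.1 h1).2]
    rw [dist_comm, Real.dist_eq, sq_sub_sq, abs_mul,
      abs_of_nonneg (add_nonneg (hu (t + 1)) (hu t))]
    calc (u (t + 1) + u t) * |u (t + 1) - u t|
        ≤ (2 * u t + K * α t) * (K * α t) :=
          mul_le_mul (by linarith) h1 (abs_nonneg _) (by linarith [hu t, hu (t + 1)])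
      _ = 2 * K * (α t * u t) + K ^ 2 * α t ^ 2 := by ring
  obtain ⟨l, hl⟩ := cauchySeq_tendsto_of_complete (cauchySeq_of_summable_dist hinc)
  have hs : Tendsto u atTop (𝓝 (Real.sqrt l)) := by
    have := (Real.continuous_sqrt.tendsto l).comp hl
    refine this.congr fun t => ?_
    simp only [Function.comp_apply, Real.sqrt_sq (hu t)]
  rcases (Real.sqrt_nonneg l).eq_or_lt with h | h
  · rwa [← h] at hs
  · refine absurd ?_ hα1
    refine Summable.of_norm_bounded_eventually_nat (hαu.mul_left (2 / Real.sqrt l)) ?_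
    filter_upwards [hs.eventually (lt_mem_nhds (half_lt_self h))] with t ht
    rw [Real.norm_of_nonneg (hα t).le, div_mul_eq_mul_div, le_div_iff₀ h]
    have := mul_le_mul_of_nonneg_left ht.le (hα t).le
    linarith

/-- Nonnegative functions with summable integrals are almost surely summable. -/
lemma ae_summable_of_summable_integral {S : Type*} [MeasurableSpace S] {P : Measure S}
    {F : ℕ → S → ℝ} (hF0 : ∀ n ω, 0 ≤ F n ω) (hFm : ∀ n, Measurable (F n))
    (hFi : ∀ n, Integrable (F n) P) (hs : Summable fun n => ∫ ω, F n ω ∂P) :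
    ∀ᵐ ω ∂P, Summable fun n => F n ω := by
  have hm : ∀ n, Measurable fun ω => ENNReal.ofReal (F n ω) := fun n => (hFm n).ennreal_ofReal
  have h1 : ∫⁻ ω, ∑' n, ENNReal.ofReal (F n ω) ∂P ≠ ⊤ := by
    rw [lintegral_tsum fun n => (hm n).aemeasurable]
    simp only [← ofReal_integral_eq_lintegral_ofReal (hFi _) (Eventually.of_forall (hF0 _))]
    exact hs.tsum_ofReal_ne_top
  filter_upwards [ae_lt_top (Measurable.tsum hm) h1] with ω hω
  refine (ENNReal.summable_toReal hω.ne).congr fun n => ?_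
  rw [ENNReal.toReal_ofReal (hF0 n ω)]

/-- A bounded sequence approaches every set that contains all its cluster points. -/
lemma tendsto_infDist_of_mapClusterPt {E : Type*} [PseudoMetricSpace E] [ProperSpace E]
    {u : ℕ → E} {C : Set E} (hb : Bornology.IsBounded (Set.range u))
    (hC : ∀ z, MapClusterPt z atTop u → z ∈ C) :
    C.Nonempty ∧ Tendsto (fun t => Metric.infDist (u t) C) atTop (𝓝 0) := by
  have hcpt : IsCompact (closure (Set.range u)) := hb.isCompact_closure
  have hmem : ∀ t, u t ∈ closure (Set.range u) := fun t => subset_closure ⟨t, rfl⟩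
  have hex : ∀ l : Filter ℕ, l ≤ atTop → l.NeBot → ∃ z ∈ C, MapClusterPt z l u := fun l hl hne => by
    obtain ⟨z, -, hz⟩ := hcpt.exists_mapClusterPt_of_frequently (l := l) (f := u)
      (Eventually.of_forall hmem).frequently
    exact ⟨z, hC z (hz.mono hl), hz⟩
  refine ⟨?_, ?_⟩
  · obtain ⟨z, hz, -⟩ := hex atTop le_rfl inferInstance
    exact ⟨z, hz⟩
  rw [Metric.tendsto_nhds]
  intro ε hε
  by_contra hcon
  have hfr : ∃ᶠ t in atTop, ε ≤ Metric.infDist (u t) C := by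
    refine (not_eventually.1 hcon).mono fun t ht => ?_
    rwa [Real.dist_0_eq_abs, abs_of_nonneg Metric.infDist_nonneg, not_lt] at ht
  obtain ⟨z, hz, hzl⟩ := hex (atTop ⊓ 𝓟 {t | ε ≤ Metric.infDist (u t) C}) inf_le_left
    (frequently_mem_iff_neBot.1 hfr)
  have hlt : ∀ᶠ y in 𝓝 z, Metric.infDist y C < ε :=
    (Metric.continuous_infDist_pt C).continuousAt.eventually_lt_const
      (by simpa only [Metric.infDist_zero_of_mem hz] using hε)
  obtain ⟨t, ht1, ht2⟩ := ((hzl.frequently hlt).and_eventually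
    (mem_inf_of_right (mem_principal_self _))).exists
  exact absurd ht1 (not_lt.2 ht2)

section Stationary

variable {E : Type*} [NormedAddCommGroup E] [InnerProductSpace ℝ E]
  {Θ : Set E} {f : E → ℝ} {ρ' : ℝ}

/-- A fixed point of the proximal map at which `f` is differentiable is stationary. -/
lemma IsProxPoint.mem_stationaryPoints [CompleteSpace E] (hc : Convex ℝ Θ) {z : E}
    (hz : IsProxPoint Θ f (1 / ρ') z z) (hd : DifferentiableAt ℝ f z) :
    z ∈ stationaryPoints Θ f := by
  obtain ⟨hzΘ, hmin⟩ := isProxPoint_iff.1 hz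
  have hgrad := hd.hasGradientAt
  set v := gradient f z
  refine ⟨hzΘ, v, ?_, -v, ?_, add_neg_cancel v⟩
  · intro ε hε
    rw [nhdsWithin_univ]
    filter_upwards [(hasGradientAt_iff_isLittleO.1 hgrad).bound hε] with w hw
    have := (abs_le.1 hw).1
    linarith
  · intro w hw
    -- the penalty term has zero derivative at `z`
    have hq : HasFDerivAt (fun y => f y + ρ' / 2 * ‖y - z‖ ^ 2)
        (InnerProductSpace.toDual ℝ E v) z := by
      have h1 : HasFDerivAt (fun y : E => ‖y - z‖ ^ 2) (0 : E →L[ℝ] ℝ) z := by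
        have := ((hasFDerivAt_id z).sub_const z).norm_sq
        simpa using this
      have h2 := hgrad.hasFDerivAt.fun_add (h1.const_mul (ρ' / 2))
      rw [smul_zero, add_zero] at h2
      exact h2
    have hloc : IsLocalMinOn (fun y => f y + ρ' / 2 * ‖y - z‖ ^ 2) Θ z := by
      filter_upwards [self_mem_nhdsWithin] with y hy using hmin y hy
    have h := hloc.hasFDerivWithinAt_nonneg hq.hasFDerivWithinAt
      (sub_mem_posTangentConeAt_of_segment_subset (hc.segment_subset hzΘ hw))
    rw [InnerProductSpace.toDual_apply_apply] at h
    rw [inner_neg_left]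
    linarith

end Stationary

section AlmostSure

variable {E : Type*} [NormedAddCommGroup E] [InnerProductSpace ℝ E] [ProperSpace E]
  [MeasurableSpace E] [BorelSpace E]
  {X S : Type*} [MeasurableSpace X] [MeasurableSpace S]
  {Θ : Set E} {f : E → ℝ} {ρ ρ' : ℝ} {π : Measure X} [IsProbabilityMeasure π] {G : E → X → E}
  {L₁ L : ℝ} {p : E → E} {α : ℕ → ℝ} {x : ℕ → S → X} {θ₁ : E} {θ : ℕ → S → E}
  {P : Measure S} [IsProbabilityMeasure P]
  {κ : (m n : ℕ) → Kernel (Finset.Icc 1 m → X) X} [∀ m n, IsMarkovKernel (κ m n)]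

/-- The rate bound shows that the gradient norms are almost surely square summable with weights
`α_t`, and they vary by `O(α_t)` per step. -/
lemma IsOracle.ae_tendsto_displacement (h : IsOracle Θ f ρ π G L₁ L) (hρ' : ρ < ρ')
    (hp : ∀ z, IsProxPoint Θ f (1 / ρ') z (p z)) (hθ : IsProjectedSGD Θ G α x θ₁ θ)
    (hx : ∀ n, 1 ≤ n → Measurable (x n))
    (hκ : ∀ m n, m < n → HasCondDistrib (x n) (history x m) (κ m n) P)
    (hα : ∀ t, 0 < α t) (hαm : Antitone α) {k : ℕ → ℕ} (hmix : MixingCondition κ π α k)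
    (hk : Summable (fun t => (k t : ℝ) * α t * α (t - k t))) (hα1 : ¬ Summable α) :
    ∀ᵐ ω ∂P, Tendsto (fun t => ‖p (θ t ω) - θ t ω‖) atTop (𝓝 0) := by
  have h0 : 0 < ρ' - ρ := by linarith
  have hρ0 : 0 < ρ' := h.rho_pos.trans hρ'
  have hL := h.bound_pos
  have hL₁ := h.lipschitz_pos
  have hα2 : Summable fun t => α (t + 1) ^ 2 := by
    refine Summable.of_nonneg_of_le (fun t => sq_nonneg _) (fun t => ?_)
      ((summable_nat_add_iff 1).2 hk)
    have h1 : (1 : ℝ) ≤ k (t + 1) := Nat.one_le_cast.2 (hmix.lag_mem (t + 1) (by omega)).1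
    have h2 : α (t + 1) ≤ α (t + 1 - k (t + 1)) := hαm (Nat.sub_le _ _)
    have h3 := hα (t + 1)
    calc α (t + 1) ^ 2 = 1 * α (t + 1) * α (t + 1) := by ring
      _ ≤ _ := by gcongr
  have hIcc : ∀ (u : ℕ → ℝ) (T : ℕ),
      ∑ t ∈ Finset.Icc 1 T, u t = ∑ t ∈ Finset.range T, u (t + 1) := fun u T => by
    rw [Finset.range_eq_Ico, Finset.sum_Ico_add' u 0 T 1]
    rfl
  have hle : ∀ u : ℕ → ℝ, (∀ t, 0 ≤ u t) → Summable (fun t => u (t + 1)) → ∀ T,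
      ∑ t ∈ Finset.Icc 1 T, u t ≤ ∑' t, u (t + 1) := fun u hu hs T => by
    rw [hIcc]
    exact hs.sum_le_tsum _ fun t _ => hu _
  have hsum : Summable fun t => ∫ ω, α (t + 1) * ‖p (θ (t + 1) ω) - θ (t + 1) ω‖ ^ 2 ∂P := by
    have hb := fun T => h.sum_expected_le (P := P) hρ' hp hθ hx hκ hα hαm (T := T)
      (fun t ht => (hmix.lag_mem t ht).2)
    have hs : Summable fun t => α (t + 1) *
        ∫ ω, (ρ' * ‖p (θ (t + 1) ω) - θ (t + 1) ω‖) ^ 2 ∂P := by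
      refine summable_of_sum_range_le (c := ρ' ^ 2 * L ^ 2 / (ρ' - ρ) *
        ((moreauEnvelope Θ f (1 / ρ') θ₁ - ⨅ z, moreauEnvelope Θ f (1 / ρ') z) / (ρ' * L ^ 2)
          + 1 / 2 * ∑' t, α (t + 1) ^ 2
          + 2 * (L₁ + ρ') / (ρ' - ρ) *
            ∑' t, (k (t + 1) : ℝ) * α (t + 1) * α (t + 1 - k (t + 1))
          + 2 / (ρ' - ρ) *
            ∑' t, α (t + 1) * mixingTV κ π (t + 1 - k (t + 1)) (t + 1 + 1)))
        (fun t => mul_nonneg (hα _).le (integral_nonneg fun ω => sq_nonneg _)) fun T => ?_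
      rw [← hIcc fun t => α t * ∫ ω, (ρ' * ‖p (θ t ω) - θ t ω‖) ^ 2 ∂P]
      refine (hb T).trans (mul_le_mul_of_nonneg_left ?_ (by positivity))
      exact add_le_add (add_le_add (add_le_add le_rfl (mul_le_mul_of_nonneg_left
        (hle (fun t => α t ^ 2) (fun t => sq_nonneg _) hα2 T) (by positivity)))
        (mul_le_mul_of_nonneg_left (hle (fun t => (k t : ℝ) * α t * α (t - k t))
          (fun t => mul_nonneg (mul_nonneg (Nat.cast_nonneg _) (hα _).le) (hα _).le)
          ((summable_nat_add_iff 1).2 hk) T) (by positivity)))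
        (mul_le_mul_of_nonneg_left (hle (fun t => α t * mixingTV κ π (t - k t) (t + 1))
          (fun t => mul_nonneg (hα _).le (mixingTV_nonneg _ _))
          ((summable_nat_add_iff 1).2 hmix.summable) T) (by positivity))
    refine (hs.mul_left (1 / ρ' ^ 2)).congr fun t => ?_
    simp only [mul_pow]
    rw [integral_const_mul, integral_const_mul]
    field_simp
  have hae := ae_summable_of_summable_integral
    (fun t ω => mul_nonneg (hα (t + 1)).le (sq_nonneg _))
    (fun t => (((h.continuous_displacement hρ' hp).measurable.comp
      (h.measurable_iterate hθ hx (t := t + 1) (by omega))).norm.pow_const 2).const_mul _)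
    (fun t => (h.integrable_displacement_sq (P := P) hρ' hp hθ hx
      (t := t + 1) (by omega)).const_mul _) hsum
  filter_upwards [hae] with ω hω
  have hsq : Tendsto (fun t => ‖p (θ (t + 1) ω) - θ (t + 1) ω‖ ^ 2) atTop (𝓝 0) := by
    refine tendsto_zero_of_summable_mul (α := fun t => α (t + 1))
      (K := 2 * (L / (ρ' - ρ)) * (ρ' / (ρ' - ρ) * L)) (fun t => hα _) (fun t => sq_nonneg _) hω
      (fun hs => hα1 ((summable_nat_add_iff 1).1 hs)) hα2 fun t => ?_
    have h1 := h.norm_displacement_le hρ' hp (hθ.mem (t := t + 1) (by omega) ω)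
    have h2 := h.norm_displacement_le hρ' hp (hθ.mem (t := t + 1 + 1) (by omega) ω)
    have h3 := hθ.norm_step_le h.weaklyConvexOn.1 hα h.bound (t := t + 1) (by omega) ω
    have h4 := h.weaklyConvexOn.displacement_lipschitz h.rho_pos.le hρ' hp
      (θ (t + 1 + 1) ω) (θ (t + 1) ω)
    have h5 := (abs_norm_sub_norm_le _ _).trans (h4.trans (mul_le_mul_of_nonneg_left h3
      (show 0 ≤ ρ' / (ρ' - ρ) by positivity)))
    rw [sq_sub_sq, abs_mul, abs_of_nonneg (by positivity)]
    refine (mul_le_mul (show _ ≤ 2 * (L / (ρ' - ρ)) by linarith) h5 (abs_nonneg _)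
      (by positivity)).trans_eq ?_
    ring
  have hsqrt := (Real.continuous_sqrt.tendsto 0).comp hsq
  rw [Real.sqrt_zero] at hsqrt
  refine (tendsto_add_atTop_iff_nat 1).1 (hsqrt.congr fun t => ?_)
  simp only [Function.comp_apply, Real.sqrt_sq (norm_nonneg _)]

end AlmostSure

end ProjSGD

/-! ### Convergence of the projected stochastic subgradient method -/

theorem mainTheorem1 {p : ℕ} {X S : Type*} [MeasurableSpace X] [MeasurableSpace S]
    -- the data: a process with conditional distributions `κ m n` of `x_n` given `x_1, …, x_m`
    (P : Measure S) [IsProbabilityMeasure P]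
    (x : ℕ → S → X) (hx : ∀ n, 1 ≤ n → Measurable (x n))
    (κ : (m n : ℕ) → Kernel (Finset.Icc 1 m → X) X) [∀ m n, IsMarkovKernel (κ m n)]
    (hκ : ∀ m n, m < n → HasCondDistrib (x n) (ProjSGD.history x m) (κ m n) P)
    (π : Measure X) [IsProbabilityMeasure π]
    -- the objective: weakly convex and bounded below on the closed convex set `Θ`
    (Θ : Set (EuclideanSpace ℝ (Fin p))) (hΘ : IsClosed Θ)
    (f : EuclideanSpace ℝ (Fin p) → ℝ) (ρ : ℝ) (hρ : 0 < ρ)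
    (hf : ProjSGD.WeaklyConvexOn Θ ρ f) (hfb : BddBelow (f '' Θ))
    -- the stochastic subgradient: unbiased under `π`, Lipschitz in `θ`, bounded
    (G : EuclideanSpace ℝ (Fin p) → X → EuclideanSpace ℝ (Fin p))
    (hGm : ∀ θ ∈ Θ, Measurable (G θ))
    (hGu : ∀ θ ∈ Θ, ∫ y, G θ y ∂π ∈ ProjSGD.subdifferential Θ f θ)
    (L₁ : ℝ) (hL₁ : 0 < L₁)
    (hGl : ∀ y, ∀ θ ∈ Θ, ∀ θ' ∈ Θ, ‖G θ y - G θ' y‖ ≤ L₁ * ‖θ - θ'‖)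
    (L : ℝ) (hL : 0 < L) (hGb : ∀ θ ∈ Θ, ∀ y, ‖G θ y‖ ≤ L)
    -- positive nonincreasing step sizes and the iterates
    (α : ℕ → ℝ) (hα : ∀ t, 0 < α t) (hαm : Antitone α)
    (θ₁ : EuclideanSpace ℝ (Fin p)) (θ : ℕ → S → EuclideanSpace ℝ (Fin p))
    (hθ : ProjSGD.IsProjectedSGD Θ G α x θ₁ θ)
    (ρ' : ℝ) (hρ' : ρ < ρ')
    -- the Moreau envelope and the norm of its gradient
    (φ : EuclideanSpace ℝ (Fin p) → ℝ) (hφ : φ = ProjSGD.moreauEnvelope Θ f (1 / ρ'))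
    (g : EuclideanSpace ℝ (Fin p) → ℝ) (hg : ∀ z, g z = ‖gradient φ z‖) :
    -- proximal points are well defined and the Moreau envelope is differentiable
    (∀ z, (∃! y, ProjSGD.IsProxPoint Θ f (1 / ρ') z y) ∧ DifferentiableAt ℝ φ z) ∧
    -- (i) rate of convergence
    (∀ k : ℕ → ℕ, ProjSGD.MixingCondition κ π α k →
      ∀ T, 1 ≤ T → ∀ out : S → EuclideanSpace ℝ (Fin p),
        (ProjSGD.IsRandomOutput P x α θ T out ∨ ProjSGD.IsBestOutput g θ T out) →
        Integrable (fun ω => g (out ω) ^ 2) P ∧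
        ∫ ω, g (out ω) ^ 2 ∂P ≤
          ρ' ^ 2 * L ^ 2 / (ρ' - ρ) * (1 / ∑ t ∈ Finset.Icc 1 T, α t) *
            ((φ θ₁ - ⨅ z, φ z) / (ρ' * L ^ 2)
              + 1 / 2 * ∑ t ∈ Finset.Icc 1 T, α t ^ 2
              + 2 * (L₁ + ρ') / (ρ' - ρ) * ∑ t ∈ Finset.Icc 1 T, (k t : ℝ) * α t * α (t - k t)
              + 2 / (ρ' - ρ) * ∑ t ∈ Finset.Icc 1 T,
                  α t * ProjSGD.mixingTV κ π (t - k t) (t + 1))) ∧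
    -- (i) sample complexity under exponential mixing
    ((∃ c : ℝ, 0 < c ∧ ∀ t : ℕ, 1 ≤ t → α t = c / Real.sqrt t) →
      ProjSGD.ExponentiallyMixing κ π →
      ∃ (K : ℝ) (q : ℕ), ∀ ε : ℝ, 0 < ε → ε ≤ 1 →
        ∀ T : ℕ, 1 ≤ T → K * (1 / ε) ^ 4 * (1 + Real.log (1 / ε)) ^ q ≤ T →
          ∀ out : S → EuclideanSpace ℝ (Fin p),
            (ProjSGD.IsRandomOutput P x α θ T out ∨ ProjSGD.IsBestOutput g θ T out) →
            Integrable (fun ω => g (out ω)) P ∧ ∫ ω, g (out ω) ∂P ≤ ε) ∧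
    -- (ii) global convergence
    (∀ k : ℕ → ℕ, ProjSGD.MixingCondition κ π α k →
      Summable (fun t => (k t : ℝ) * α t * α (t - k t)) → ¬ Summable α →
      (∀ᵐ ω ∂P, Tendsto (fun t => g (θ t ω)) atTop (𝓝 0) ∧
        Tendsto (fun t => g (ProjSGD.prox Θ f (1 / ρ') (θ t ω))) atTop (𝓝 0)) ∧
      ((∃ U, IsOpen U ∧ Θ ⊆ U ∧ ContDiffOn ℝ 1 f U) →
        ∀ᵐ ω ∂P,
          (∀ z, MapClusterPt z atTop (fun t => θ t ω) → z ∈ ProjSGD.stationaryPoints Θ f) ∧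
          (Bornology.IsBounded (Set.range (fun t => θ t ω)) →
            (ProjSGD.stationaryPoints Θ f).Nonempty ∧
            Tendsto (fun t => Metric.infDist (θ t ω) (ProjSGD.stationaryPoints Θ f))
              atTop (𝓝 0)))) := by
  have h : ProjSGD.IsOracle Θ f ρ π G L₁ L :=
    ⟨hΘ, ⟨θ₁, hθ.init_mem⟩, hρ, hf, hfb, hGm, hGu, hL₁, hGl, hL, hGb⟩
  have hρ0 : 0 < ρ' := hρ.trans hρ'
  have h0 : 0 < ρ' - ρ := by linarith
  have hp : ∀ z, ProjSGD.IsProxPoint Θ f (1 / ρ') z (ProjSGD.prox Θ f (1 / ρ') z) := fun z =>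
    Classical.epsilon_spec (h.exists_isProxPoint hρ' z)
  set p := ProjSGD.prox Θ f (1 / ρ')
  have hgrad : ∀ z, HasGradientAt φ (ρ' • (z - p z)) z := fun z => by
    rw [hφ]
    exact hf.hasGradientAt_moreauEnvelope hfb hρ.le hρ' hp z
  have hgp : ∀ z, g z = ρ' * ‖p z - z‖ := fun z => by
    rw [hg, (hgrad z).gradient, norm_smul, Real.norm_of_nonneg hρ0.le, norm_sub_rev]
  refine ⟨fun z => ⟨⟨p z, hp z, fun y hy => hf.prox_unique hρ' (hp z) hy⟩,
    (hgrad z).differentiableAt⟩, ?_, ?_, ?_⟩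
  · intro k hk T hT out hout
    obtain ⟨-, hi, hle⟩ := h.output_le hρ' hp hθ hx hα hgp hT hout
    refine ⟨hi, hle.trans ?_⟩
    have hS := ProjSGD.sum_Icc_pos hα hT
    have hsum := h.sum_expected_le (P := P) (κ := κ) hρ' hp hθ hx hκ hα hαm (T := T)
      (fun t ht => (hk.lag_mem t ht).2)
    simp only [← hgp, ← hφ] at hsum
    refine (mul_le_mul_of_nonneg_left hsum (one_div_nonneg.2 hS.le)).trans_eq ?_
    ring
  · rintro ⟨c, hc, hαc⟩ hmix
    exact h.sample_complexity hρ' hp hθ hx hκ hα hαm hc hαc hmix hgp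
  · intro k hk hks hα1
    have hae := h.ae_tendsto_displacement hρ' hp hθ hx hκ hα hαm hk hks hα1
    refine ⟨?_, ?_⟩
    · filter_upwards [hae] with ω hω
      refine ⟨?_, ?_⟩
      · simp only [hgp]
        simpa using hω.const_mul ρ'
      · have hbd : ∀ t, g (p (θ t ω)) ≤
            ρ' * ((1 + ρ' / (ρ' - ρ)) * ‖p (θ t ω) - θ t ω‖) := fun t => by
          rw [hgp]
          refine mul_le_mul_of_nonneg_left ?_ hρ0.le
          have h1 := hf.displacement_lipschitz hρ.le hρ' hp (p (θ t ω)) (θ t ω)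
          have h2 := norm_sub_norm_le (p (p (θ t ω)) - p (θ t ω)) (p (θ t ω) - θ t ω)
          linarith
        refine squeeze_zero (fun t => by rw [hg]; exact norm_nonneg _) hbd ?_
        simpa using (hω.const_mul (1 + ρ' / (ρ' - ρ))).const_mul ρ'
    · rintro ⟨U, hU, hΘU, hfU⟩
      filter_upwards [hae] with ω hω
      have hcl : ∀ z, MapClusterPt z atTop (fun t => θ t ω) →
          z ∈ ProjSGD.stationaryPoints Θ f := fun z hz => by
        have hzΘ : z ∈ Θ := hΘ.mem_of_mapClusterPt hz
          (eventually_atTop.2 ⟨1, fun t ht => hθ.mem ht ω⟩)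
        -- the displacement vanishes at the limit point by continuity
        have hD : ‖p z - z‖ = 0 := by
          have h1 := hz.tendsto_comp ((h.continuous_displacement hρ' hp).norm.tendsto z)
          obtain ⟨ψ, hψ, hlim⟩ := h1.tendsto_subseq
          exact tendsto_nhds_unique hlim (hω.comp hψ.tendsto_atTop)
        have hpz : p z = z := sub_eq_zero.1 (norm_eq_zero.1 hD)
        have hzz := hp z
        rw [hpz] at hzz
        exact hzz.mem_stationaryPoints hf.1 ((hfU.contDiffAt
          (hU.mem_nhds (hΘU hzΘ))).differentiableAt one_ne_zero)
      exact ⟨hcl, fun hb => ProjSGD.tendsto_infDist_of_mapClusterPt hb hcl⟩
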